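/- Let $\mathbb{D}=\{z\in\mathbb{C}:|z|<1\}$ and $\overline{\mathbb{C}}=\mathbb{C}\cup\{\infty\}$. For $p\in(0,1)$ let $Co(p)$ be the family of functions $f:\mathbb{D}\to\overline{\mathbb{C}}$ such that (i) $f$ is meromorphic in $\mathbb{D}$ and has a simple pole at $p$; (ii) $f(0)=f'(0)-1=0$; (iii) $f$ maps $\mathbb{D}$ conformally (injectively) onto a set whose complement with respect to $\overline{\mathbb{C}}$ is convex. Let $\mathcal{R}(p)$ be the class of all functions $$f_\omega(z)=\frac{z-\frac{p}{1+p^2}\,(1+\omega(z))\,z^2}{\left(1-\frac{z}{p}\right)(1-zp)},\qquad z\in\mathbb{D},$$ where $\omega:\mathbb{D}\to\overline{\mathbb{D}}$ is holomorphic (so that $f_\omega(p)=\infty$). Theorem. Let $p\in\left(1-\frac{\sqrt2}{2},1\right)$. Then the closed convex hull of $Co(p)$, in the topology of locally uniform convergence on $\mathbb{D}$ of functions with values in $\overline{\mathbb{C}}$, is a proper subset of $\mathcal{R}(p)$. More precisely, the closed convex hull is contained in $\mathcal{R}(p)$, and there is an $x\in(0,1)$ such that $$\omega_x(z)=\frac{-\frac{z-p}{1-pz}-x}{1+x\,\frac{z-p}{1-pz}}$$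 is a holomorphic automorphism of $\mathbb{D}$, the function $f_{\omega_x}\in\mathcal{R}(p)$ does not belong to the closed convex hull of $Co(p)$, and in the Laurent expansion $f_{\omega_x}(z)=\sum_{n=-1}^{\infty}a_n(z-p)^n$, $0<|z-p|<1-p$, the coefficient $a_1$ is real with $$a_1<-\frac{p^2}{(1-p^2)^3};$$ in particular $a_1$ violates the inequality $|a_1|\le\frac{p^2}{(1-p^2)^3}$. -/

import Mathlib

open Set Metric

noncomputable section

namespace ConcaveUnivalent

/-- The open unit disc. -/
abbrev Disc : Type := ball (0 : ℂ) 1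

/-- The Riemann sphere. -/
abbrev Sphere : Type := OnePoint ℂ

/-- The Riemann sphere is compact and Hausdorff, so its topology is induced by exactly one
uniform structure, which is the one of the chordal metric. -/
instance sphereUniformSpace : UniformSpace Sphere := uniformSpaceOfCompactR1

/-- The map from the disc to the Riemann sphere that has the value `∞` at `p` and agrees with the
complex-valued function `F` elsewhere. Neither `F p` nor the values of `F` outside the disc matter. -/
def withPole (p : ℝ) (F : ℂ → ℂ) : Disc → Sphere := fun z =>
  open Classical in if (z : ℂ) = p then OnePoint.infty else ((F z : ℂ) : Sphere)

/-- The class `Co(p)`. Since `f` is injective on the disc and has a pole at `p`, it has no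
further poles, so that `f` is meromorphic in the disc precisely when its finite part `F` is
holomorphic off `p` and has a pole at `p`. Since `∞` lies in the range of `f`, the complement
of the range in the Riemann sphere is a set of complex numbers. -/
def Co (p : ℝ) : Set (Disc → Sphere) :=
  {f | ∃ F : ℂ → ℂ,
      f = withPole p F ∧
      DifferentiableOn ℂ F (ball (0 : ℂ) 1 \ {(p : ℂ)}) ∧
      meromorphicOrderAt F (p : ℂ) = ((-1 : ℤ) : WithTop ℤ) ∧
      F 0 = 0 ∧ deriv F 0 = 1 ∧
      Function.Injective f ∧
      Convex ℝ {w : ℂ | (w : Sphere) ∉ range f}}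

/-- The convex hull of a set of sphere-valued functions with pole at `p`: convex
combinations are formed pointwise off `p`, and have the value `∞` at `p`. -/
def convexHullWithPole (p : ℝ) (S : Set (Disc → Sphere)) : Set (Disc → Sphere) :=
  withPole p '' convexHull ℝ (withPole p ⁻¹' S)

/-- The closure of a set of sphere-valued functions on the disc in the topology of uniform
convergence on compact subsets of the disc. -/
def compactConvergenceClosure (S : Set (Disc → Sphere)) : Set (Disc → Sphere) :=
  UniformOnFun.ofFun {K : Set Disc | IsCompact K} ⁻¹'
    closure (UniformOnFun.ofFun {K : Set Disc | IsCompact K} '' S)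

/-- The closed convex hull of `Co(p)`. -/
def closedConvexHullCo (p : ℝ) : Set (Disc → Sphere) :=
  compactConvergenceClosure (convexHullWithPole p (Co p))

/-- The expression
`(z - p / (1 + p ^ 2) * (1 + ω z) * z ^ 2) / ((1 - z / p) * (1 - z * p))`. -/
def reprFormula (p : ℝ) (ω : ℂ → ℂ) (z : ℂ) : ℂ :=
  (z - (p : ℂ) / (1 + (p : ℂ) ^ 2) * (1 + ω z) * z ^ 2) /
    ((1 - z / (p : ℂ)) * (1 - z * (p : ℂ)))

/-- The class of all functions given by `reprFormula` with `ω` holomorphic from the open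
unit disc to the closed unit disc. -/
def reprClass (p : ℝ) : Set (Disc → Sphere) :=
  {f | ∃ ω : ℂ → ℂ, DifferentiableOn ℂ ω (ball (0 : ℂ) 1) ∧
      (∀ z ∈ ball (0 : ℂ) 1, ‖ω z‖ ≤ 1) ∧ f = withPole p (reprFormula p ω)}

/-- The disc automorphism
`ω_x(z) = (- (z - p) / (1 - p z) - x) / (1 + x (z - p) / (1 - p z))`. -/
def omegaX (p x : ℝ) (z : ℂ) : ℂ :=
  (-((z - (p : ℂ)) / (1 - (p : ℂ) * z)) - (x : ℂ)) /
    (1 + (x : ℂ) * ((z - (p : ℂ)) / (1 - (p : ℂ) * z)))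

/-- `f(z) = ∑_{n ≥ -1} a_n (z - p)^n` for `0 < |z - p| < 1 - p`. -/
def HasLaurentExpansion (p : ℝ) (f : Disc → Sphere) (a : ℤ → ℂ) : Prop :=
  ∀ z : Disc, (z : ℂ) ≠ p → ‖(z : ℂ) - p‖ < 1 - p →
    ∃ w : ℂ, f z = (w : Sphere) ∧
      HasSum (fun k : ℕ => a ((k : ℤ) - 1) * ((z : ℂ) - p) ^ ((k : ℤ) - 1)) w

end ConcaveUnivalent

end

/-! Two conditions on functions with a pole at `p` carry the proof: the function `ω` solved from the
representation is bounded by 1, and `Re a₁ ≥ -p²/(1-p²)³`. Both survive convex combinations and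
locally uniform limits (`admissible`), so once they hold on `Co p` they hold on its closed convex
hull. The first gives the inclusion in the class R(p); the second excludes `f_{ω_x}` as soon as its
coefficient `a₁` is smaller.

Both conditions follow from one two-point inequality. A disc automorphism moves the pole to the
origin, where the function becomes `F s = A s / s`. A maximum principle argument
(`norm_le_of_eq_add`) shows that convexity of the complement is inherited by the images of smaller
discs. Hence `P(z,ζ) = -2zF'(z)/(F(z)-F(ζ)) + (z+ζ)/(z-ζ)` has nonnegative real part for `|z| =
|ζ|`, `z ≠ ζ`. As `P = 1` when exactly one variable vanishes, a Schwarz lemma in each variable gives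
`|P-1| ≤ |z||ζ||P+1|` (`norm_twoPoint_sub_one_le`).

At `z = -p`, the point that corresponds to the normalisation point 0, this inequality turns into
`|ω| ≤ 1` (`norm_solveOmega_le`). Letting `ζ → 0` instead gives `|A(0) + zA'(z) - A(z)| ≤
|A(0)||z|²`. At `z = -p` this bounds `|A(0)|`, and as `z → 0` it bounds the quadratic Taylor
coefficient of `A` by `|A(0)|`; together these bound `a₁`.

For `ω = -1`, which is `ω_x` at `x = 1`, the bound on `a₁` is attained. For `x < 1` the deviation is
governed by `(1-x)E(x)` with `E(1) = 2(1-p)² - 1`, which is negative precisely because `p > 1 -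
√2/2`; so every `x` close to 1 violates the bound. -/

noncomputable section

namespace ConcaveUnivalent

open Filter Topology Function

/-! ### Injective holomorphic functions, maximum principle and a Schwarz lemma -/

section ComplexAnalysis

/-- The derivative of an injective holomorphic function has no zeros. -/
theorem deriv_ne_zero_of_injOn {U : Set ℂ} {F : ℂ → ℂ} (hU : IsOpen U)
    (hd : DifferentiableOn ℂ F U) (hi : InjOn F U) {a : ℂ} (ha : a ∈ U) : deriv F a ≠ 0 := by
  intro h0
  have hFa : AnalyticAt ℂ F a := hd.analyticAt (hU.mem_nhds ha)
  have hG : AnalyticAt ℂ (fun z => F z - F a) a := hFa.sub analyticAt_const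
  have hne : ¬ ∀ᶠ z in 𝓝 a, F z - F a = 0 := by
    intro h
    obtain ⟨z, hz, hza⟩ := ((eventually_nhdsWithin_of_eventually_nhds
      (h.and (hU.mem_nhds ha))).and (self_mem_nhdsWithin (s := {a}ᶜ))).exists
    exact hza (hi hz.2 ha (sub_eq_zero.1 hz.1))
  obtain ⟨n, g, hg, hga, hGg⟩ := hG.exists_eventuallyEq_pow_smul_nonzero_iff.2 hne
  have hn0 : n ≠ 0 := by
    rintro rfl
    have := hGg.self_of_nhds
    simp at this
    exact hga this.symm
  have hn1 : n ≠ 1 := by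
    rintro rfl
    have h1 : HasDerivAt (fun z => (z - a) * g z) (1 * g a + (a - a) * deriv g a) a :=
      ((hasDerivAt_id a).sub_const a).mul hg.differentiableAt.hasDerivAt
    have h2 : HasDerivAt (fun z => F z - F a) (deriv F a) a :=
      hFa.differentiableAt.hasDerivAt.sub_const _
    have h3 := (h1.congr_of_eventuallyEq (hGg.mono fun z hz => by simpa using hz)).unique h2
    rw [h0] at h3
    simp at h3
    exact hga h3
  -- Now `n ≥ 2`. An analytic `n`-th root `k` of `g` makes `F - F a` the `n`-th power of the local
  -- homeomorphism `(z - a) * k z`. The logarithm is taken of `g z / g a`, which is near 1, to stay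
  -- away from the branch cut.
  obtain ⟨c, hc⟩ := IsAlgClosed.exists_pow_nat_eq (g a) (Nat.pos_of_ne_zero hn0)
  have hc0 : c ≠ 0 := by
    rintro rfl
    rw [zero_pow hn0] at hc
    exact hga hc.symm
  set k : ℂ → ℂ := fun z => c * Complex.exp (Complex.log (g z / g a) / n) with hk
  have hka : k a = c := by simp [hk, div_self hga]
  have hkan : AnalyticAt ℂ k a := by
    refine analyticAt_const.mul (AnalyticAt.cexp ((AnalyticAt.clog (hg.div analyticAt_const hga)
      ?_).div analyticAt_const (by exact_mod_cast hn0)))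
    simp [div_self hga]
  have hkn : ∀ᶠ z in 𝓝 a, k z ^ n = g z := by
    filter_upwards [hg.continuousAt.eventually_ne hga] with z hz
    rw [hk]
    simp only
    rw [mul_pow, hc, ← Complex.exp_nat_mul, mul_div_cancel₀ _ (by exact_mod_cast hn0),
      Complex.exp_log (div_ne_zero hz hga), mul_div_cancel₀ _ hga]
  have hφan : AnalyticAt ℂ (fun z => (z - a) * k z) a :=
    (analyticAt_id.sub analyticAt_const).mul hkan
  have hφ : HasStrictDerivAt (fun z => (z - a) * k z) c a := by
    have h1 : HasDerivAt (fun z => (z - a) * k z) (1 * k a + (a - a) * deriv k a) a :=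
      ((hasDerivAt_id a).sub_const a).mul hkan.differentiableAt.hasDerivAt
    have h2 := hφan.hasStrictDerivAt
    rw [h1.deriv] at h2
    simpa [hka] using h2
  have hmap := hφ.map_nhds_eq hc0
  simp only [sub_self, zero_mul] at hmap
  obtain ⟨V, hV, hVp⟩ := ((hkn.and hGg).and (hU.mem_nhds ha)).exists_mem
  have hVi : (fun z => (z - a) * k z) '' V ∈ 𝓝 (0 : ℂ) := hmap ▸ image_mem_map hV
  -- The preimages of `w` and `ω * w` under the local homeomorphism have the same image under `F`;
  -- injectivity then forces `ω = 1`.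
  set ω : ℂ := Complex.exp (2 * Real.pi * Complex.I / n) with hω
  have hprim : IsPrimitiveRoot ω n := Complex.isPrimitiveRoot_exp n hn0
  have hVi2 : ∀ᶠ w in 𝓝 (0 : ℂ), ω * w ∈ (fun z => (z - a) * k z) '' V := by
    have : Tendsto (fun w : ℂ => ω * w) (𝓝 0) (𝓝 0) := by
      have h : Continuous fun w : ℂ => ω * w := by fun_prop
      simpa using h.tendsto 0
    exact this.eventually hVi
  obtain ⟨w, ⟨⟨z2, hz2, e2⟩, ⟨z1, hz1, e1⟩⟩, hw0⟩ := ((eventually_nhdsWithin_of_eventually_nhds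
    (hVi2.and hVi)).and (self_mem_nhdsWithin (s := {(0 : ℂ)}ᶜ))).exists
  have key : ∀ z ∈ V, F z - F a = ((z - a) * k z) ^ n := fun z hz => by
    rw [(hVp z hz).1.2, mul_pow, (hVp z hz).1.1, smul_eq_mul]
  simp only at e1 e2
  have hF : F z1 = F z2 := by
    have a1 := key z1 hz1
    have a2 := key z2 hz2
    rw [e1] at a1
    rw [e2, mul_pow, hprim.pow_eq_one, one_mul, ← a1] at a2
    exact (sub_left_inj.1 a2).symm
  have hzz := hi (hVp z1 hz1).2 (hVp z2 hz2).2 hF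
  rw [← hzz, e1] at e2
  have hω1 : ω = 1 := mul_right_cancel₀ hw0 (by rw [one_mul]; exact e2.symm)
  rw [hω1] at hprim
  exact hn1 (hprim.unique IsPrimitiveRoot.one)

theorem hasStrictDerivAt_of_differentiableOn {U : Set ℂ} {F : ℂ → ℂ} (hU : IsOpen U)
    (hd : DifferentiableOn ℂ F U) {a : ℂ} (ha : a ∈ U) : HasStrictDerivAt F (deriv F a) a :=
  (hd.analyticAt (hU.mem_nhds ha)).hasStrictDerivAt

theorem map_nhds_of_injOn {U : Set ℂ} {F : ℂ → ℂ} (hU : IsOpen U)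
    (hd : DifferentiableOn ℂ F U) (hi : InjOn F U) {a : ℂ} (ha : a ∈ U) :
    map F (𝓝 a) = 𝓝 (F a) :=
  (hasStrictDerivAt_of_differentiableOn hU hd ha).map_nhds_eq (deriv_ne_zero_of_injOn hU hd hi ha)

/-- Injective holomorphic functions are open maps. -/
theorem isOpen_image_of_injOn {U V : Set ℂ} {F : ℂ → ℂ} (hU : IsOpen U)
    (hd : DifferentiableOn ℂ F U) (hi : InjOn F U) (hV : IsOpen V) (hVU : V ⊆ U) :
    IsOpen (F '' V) := by
  rw [isOpen_iff_mem_nhds]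
  rintro _ ⟨z, hz, rfl⟩
  rw [← map_nhds_of_injOn hU hd hi (hVU hz)]
  exact image_mem_map (hV.mem_nhds hz)

/-- The inverse of an injective holomorphic function is holomorphic. -/
theorem hasDerivAt_invFunOn {U : Set ℂ} {F : ℂ → ℂ} (hU : IsOpen U)
    (hd : DifferentiableOn ℂ F U) (hi : InjOn F U) {a : ℂ} (ha : a ∈ U) :
    HasDerivAt (invFunOn F U) (deriv F a)⁻¹ (F a) := by
  have hleft : ∀ z ∈ U, invFunOn F U (F z) = z := fun z hz => hi.leftInvOn_invFunOn hz
  refine HasDerivAt.of_local_left_inverse (f := F) ?_ ?_ (deriv_ne_zero_of_injOn hU hd hi ha) ?_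
  · rw [ContinuousAt, hleft a ha, ← map_nhds_of_injOn hU hd hi ha, tendsto_map'_iff]
    refine tendsto_id.congr' ?_
    filter_upwards [hU.mem_nhds ha] with z hz using (hleft z hz).symm
  · rw [hleft a ha]
    exact (hasStrictDerivAt_of_differentiableOn hU hd ha).hasDerivAt
  · rw [← map_nhds_of_injOn hU hd hi ha, eventually_map]
    filter_upwards [hU.mem_nhds ha] with z hz
    rw [hleft z hz]

/-- A version of the maximum principle for functions without continuous boundary values. -/
theorem norm_le_one_of_superlevel_subset_compact {U : Set ℂ} {u : ℂ → ℂ} (hU : IsOpen U)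
    (hb : Bornology.IsBounded U) (hd : DifferentiableOn ℂ u U)
    (h : ∀ ε > 0, ∃ K ⊆ U, IsCompact K ∧ ∀ z ∈ U, 1 + ε ≤ ‖u z‖ → z ∈ K) :
    ∀ z ∈ U, ‖u z‖ ≤ 1 := by
  intro z hz
  by_contra! hlt
  set ε := (‖u z‖ - 1) / 2 with hε
  have hε0 : 0 < ε := by linarith
  obtain ⟨K, hKU, hK, hKs⟩ := h ε hε0
  -- The closure of `V` stays in the compact set `K`, so the usual maximum principle applies on `V`,
  -- where `‖u‖ ≤ 1 + ε` on the frontier.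
  set V : Set ℂ := U ∩ (fun z => ‖u z‖) ⁻¹' Ioi (1 + ε) with hV
  have hVo : IsOpen V := hd.continuousOn.norm.isOpen_inter_preimage hU isOpen_Ioi
  have hVK : V ⊆ K := fun w hw => hKs w hw.1 (le_of_lt hw.2)
  have hclV : closure V ⊆ U := (closure_minimal hVK hK.isClosed).trans hKU
  have hzV : z ∈ V := ⟨hz, by simp only [mem_preimage, mem_Ioi]; linarith⟩
  have := Complex.norm_le_of_forall_mem_frontier_norm_le (hb.subset inter_subset_left)
    (DifferentiableOn.diffContOnCl (hd.mono hclV)) (C := 1 + ε) (f := u) (fun w hw => ?_)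
    (subset_closure hzV)
  · linarith
  · rw [hVo.frontier_eq] at hw
    by_contra! hlt'
    exact hw.2 ⟨hclV hw.1, hlt'⟩

/-- Removable singularity theorem for functions that are `o(1 / (z - a))`. -/
theorem exists_differentiableOn_extension {U : Set ℂ} {a : ℂ} {Q : ℂ → ℂ} (hU : U ∈ 𝓝 a)
    (hd : DifferentiableOn ℂ Q (U \ {a}))
    (ho : Tendsto (fun z => (z - a) * Q z) (𝓝[≠] a) (𝓝 0)) :
    ∃ Q' : ℂ → ℂ, DifferentiableOn ℂ Q' U ∧ ∀ z ≠ a, Q' z = Q z := by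
  refine ⟨_, Complex.differentiableOn_update_limUnder_of_isLittleO hU hd ?_,
    fun z hz => update_of_ne hz _ _⟩
  rw [Asymptotics.isLittleO_iff_tendsto']
  · have h1 : Tendsto (fun z => (z - a) * Q a) (𝓝[≠] a) (𝓝 0) := by
      have : Continuous fun z : ℂ => (z - a) * Q a := by fun_prop
      simpa using (this.tendsto a).mono_left nhdsWithin_le_nhds
    have h2 := ho.sub h1
    rw [sub_zero] at h2
    refine h2.congr fun z => ?_
    rw [div_inv_eq_mul]
    ring
  · filter_upwards [self_mem_nhdsWithin] with z hz h
    exact absurd (inv_eq_zero.1 h) (sub_ne_zero.2 hz)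

/-- Small rotations of `a` approach `a` along the circle. This lets a boundary inequality extend by
continuity to a removable singularity lying on the circle. -/
theorem subset_closure_sphere_diff_singleton {r : ℝ} (hr : 0 < r) (a : ℂ) :
    sphere (0 : ℂ) r ⊆ closure (sphere (0 : ℂ) r \ {a}) := by
  intro z hz
  by_cases hza : z = a
  · subst hza
    have hz0 : z ≠ 0 := by rintro rfl; simp at hz; exact hr.ne hz
    refine mem_closure_of_tendsto (f := fun n : ℕ => z * Complex.exp
      (((n : ℝ) + 1)⁻¹ * Complex.I)) (b := atTop) ?_ (Eventually.of_forall fun n => ⟨?_, ?_⟩)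
    · have h1 : Tendsto (fun n : ℕ => (((n : ℝ) + 1)⁻¹ : ℝ)) atTop (𝓝 0) := by
        simpa using tendsto_one_div_add_atTop_nhds_zero_nat (𝕜 := ℝ)
      have h2 : Continuous fun t : ℝ => z * Complex.exp (t * Complex.I) := by fun_prop
      have h3 := (h2.tendsto 0).comp h1
      simp only [Complex.ofReal_zero, zero_mul, Complex.exp_zero, mul_one] at h3
      refine h3.congr fun n => ?_
      simp
    · have := Complex.norm_exp_ofReal_mul_I (((n : ℝ) + 1)⁻¹)
      rw [mem_sphere_zero_iff_norm] at hz ⊢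
      rw [norm_mul, this, mul_one, hz]
    · rw [mem_singleton_iff]
      intro h
      have h1 : Complex.exp (((n : ℝ) + 1)⁻¹ * Complex.I) = 1 :=
        mul_left_cancel₀ hz0 (by rw [h, mul_one])
      rw [Complex.exp_eq_one_iff] at h1
      obtain ⟨m, hm⟩ := h1
      have h2 : (((n : ℝ) + 1)⁻¹ : ℂ) = m * (2 * Real.pi) := by
        apply mul_right_cancel₀ Complex.I_ne_zero
        rw [mul_assoc, mul_assoc, ← mul_assoc 2, ← hm]; push_cast; ring
      have h3 : ((n : ℝ) + 1)⁻¹ = m * (2 * Real.pi) := by exact_mod_cast h2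
      have h4 : (0 : ℝ) < ((n : ℝ) + 1)⁻¹ := by positivity
      have h5 : ((n : ℝ) + 1)⁻¹ ≤ 1 := inv_le_one_of_one_le₀ (by linarith [n.cast_nonneg (α := ℝ)])
      have hpi := Real.pi_gt_three
      have h6 : (0 : ℝ) < m := by
        by_contra! h
        nlinarith
      have h7 : (1 : ℝ) ≤ m := by exact_mod_cast (by exact_mod_cast h6 : (0 : ℤ) < m)
      nlinarith
  · exact subset_closure ⟨hz, hza⟩

theorem norm_sub_one_le_norm_add_one_iff (q : ℂ) : ‖q - 1‖ ≤ ‖q + 1‖ ↔ 0 ≤ q.re := by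
  rw [← sq_le_sq₀ (norm_nonneg _) (norm_nonneg _), Complex.sq_norm, Complex.sq_norm,
    Complex.normSq_apply, Complex.normSq_apply]
  simp
  constructor <;> intro h <;> nlinarith

/-- A Schwarz lemma for functions with positive real part and a removable singularity. -/
theorem norm_sub_one_le_of_sphere {Q : ℂ → ℂ} {a : ℂ} {r M : ℝ} (hr : 0 < r) (hr1 : r < 1)
    (ha : a ∈ ball (0 : ℂ) 1) (ha0 : a ≠ 0) (hd : DifferentiableOn ℂ Q (ball 0 1 \ {a}))
    (ho : Tendsto (fun z => (z - a) * Q z) (𝓝[≠] a) (𝓝 0)) (h1 : Q 0 = 1) (hM : M ≤ 1)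
    (hs : ∀ z ∈ sphere (0 : ℂ) r, z ≠ a → ‖Q z - 1‖ ≤ M * ‖Q z + 1‖) {z : ℂ} (hz : ‖z‖ ≤ r)
    (hza : z ≠ a) : ‖Q z - 1‖ ≤ M * (‖z‖ / r) * ‖Q z + 1‖ := by
  obtain ⟨q, hq, hqQ⟩ := exists_differentiableOn_extension (isOpen_ball.mem_nhds ha) hd ho
  have hsub : closedBall (0 : ℂ) r ⊆ ball 0 1 := closedBall_subset_ball hr1
  have hs' : ∀ z ∈ sphere (0 : ℂ) r, ‖q z - 1‖ ≤ M * ‖q z + 1‖ := by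
    have hc : ContinuousOn q (sphere (0 : ℂ) r) :=
      hq.continuousOn.mono (sphere_subset_closedBall.trans hsub)
    have hcl : IsClosed (sphere (0 : ℂ) r ∩ {z | ‖q z - 1‖ ≤ M * ‖q z + 1‖}) := by
      have := ContinuousOn.preimage_isClosed_of_isClosed
        (f := fun z => M * ‖q z + 1‖ - ‖q z - 1‖) (s := sphere (0 : ℂ) r) (t := Ici 0)
        (by fun_prop) isClosed_sphere isClosed_Ici
      simpa only [preimage, mem_Ici, sub_nonneg] using this
    have hmin : sphere (0 : ℂ) r \ {a} ⊆ sphere (0 : ℂ) r ∩ {z | ‖q z - 1‖ ≤ M * ‖q z + 1‖} :=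
      fun w hw => ⟨hw.1, by
        have := hs w hw.1 hw.2
        rwa [← hqQ w hw.2] at this⟩
    exact fun w hw => (closure_minimal hmin hcl (subset_closure_sphere_diff_singleton hr a hw)).2
  -- The maximum principle for `exp (-q)`, whose modulus is `exp (-Re q)`, carries the sign of the
  -- real part from the circle to the disc, so that `q + 1` has no zeros.
  have hre : ∀ z ∈ closedBall (0 : ℂ) r, 0 ≤ (q z).re := by
    intro w hw
    have hexp : ‖Complex.exp (-q w)‖ ≤ 1 := by
      refine Complex.norm_le_of_forall_mem_frontier_norm_le (f := fun z => Complex.exp (-q z))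
        isBounded_ball (U := ball (0 : ℂ) r) (DifferentiableOn.diffContOnCl ?_) ?_ ?_
      · rw [closure_ball _ hr.ne']
        exact (hq.mono hsub).neg.cexp
      · rw [frontier_ball _ hr.ne']
        intro z hz
        rw [Complex.norm_exp, Real.exp_le_one_iff, Complex.neg_re, neg_nonpos,
          ← norm_sub_one_le_norm_add_one_iff]
        exact (hs' z hz).trans (mul_le_of_le_one_left (norm_nonneg _) hM)
      · rwa [closure_ball _ hr.ne']
    rw [Complex.norm_exp, Real.exp_le_one_iff, Complex.neg_re, neg_nonpos] at hexp
    exact hexp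
  have hne : ∀ z ∈ closedBall (0 : ℂ) r, q z + 1 ≠ 0 := by
    intro w hw h
    have := hre w hw
    rw [eq_neg_of_add_eq_zero_left h] at this
    simp at this
    linarith
  -- The Cayley transform vanishes at the origin; the maximum principle for `w z / z`, bounded by `M
  -- / r` on the circle, is the Schwarz lemma.
  set w : ℂ → ℂ := fun z => (q z - 1) / (q z + 1) with hw
  have hwd : DifferentiableOn ℂ w (closedBall 0 r) :=
    ((hq.mono hsub).sub_const 1).div ((hq.mono hsub).add_const 1) hne
  have hw0 : w 0 = 0 := by simp [hw, hqQ 0 ha0.symm, h1]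
  have hdd : DifferentiableOn ℂ (dslope w 0) (closedBall 0 r) :=
    (Complex.differentiableOn_dslope (closedBall_mem_nhds _ hr)).2 hwd
  have hzr : z ∈ closedBall (0 : ℂ) r := by simpa using hz
  have hmain : ‖dslope w 0 z‖ ≤ M / r := by
    refine Complex.norm_le_of_forall_mem_frontier_norm_le (U := ball (0 : ℂ) r) isBounded_ball
      (DifferentiableOn.diffContOnCl ?_) ?_ ?_
    · rwa [closure_ball _ hr.ne']
    · rw [frontier_ball _ hr.ne']
      intro z hz
      have hz' := mem_sphere_zero_iff_norm.1 hz
      have hz0 : z ≠ 0 := by rintro rfl; rw [norm_zero] at hz'; exact hr.ne hz'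
      rw [dslope_of_ne _ hz0, slope_def_field, hw0, sub_zero, sub_zero, norm_div, hz']
      gcongr
      rw [hw]
      simp only
      rw [norm_div, div_le_iff₀ (norm_pos_iff.2 (hne z (sphere_subset_closedBall hz)))]
      exact hs' z hz
    · rwa [closure_ball _ hr.ne']
  have hwz : w z = z * dslope w 0 z := by
    have := sub_smul_dslope w 0 z
    rw [hw0, sub_zero, sub_zero, smul_eq_mul] at this
    exact this.symm
  have : q z - 1 = z * dslope w 0 z * (q z + 1) := by
    rw [← hwz, hw]
    exact (div_mul_cancel₀ _ (hne z hzr)).symm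
  rw [← hqQ z hza, this, norm_mul, norm_mul]
  have : M * (‖z‖ / r) = ‖z‖ * (M / r) := by ring
  rw [this]
  gcongr

end ComplexAnalysis

/-! ### Concave functions with pole at the origin -/

section PoleAtZero

/-- The function `z ↦ A z / z` is injective in the punctured disc, has a simple pole at the origin,
and its range has a convex complement. -/
structure IsConcaveAtZero (A : ℂ → ℂ) : Prop where
  differentiableOn : DifferentiableOn ℂ A (ball 0 1)
  ne_zero : A 0 ≠ 0
  injOn : InjOn (fun z => A z / z) (ball 0 1 \ {0})
  convex : Convex ℝ ((fun z => A z / z) '' (ball 0 1 \ {0}))ᶜ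

theorem isOpen_puncturedDisc : IsOpen (ball (0 : ℂ) 1 \ {0}) :=
  isOpen_ball.sdiff isClosed_singleton

namespace IsConcaveAtZero

variable {A : ℂ → ℂ}

theorem differentiableOn_div (hA : IsConcaveAtZero A) :
    DifferentiableOn ℂ (fun z => A z / z) (ball 0 1 \ {0}) :=
  (hA.differentiableOn.mono sdiff_subset).div differentiableOn_id fun _ hz => hz.2

theorem hasDerivAt (hA : IsConcaveAtZero A) {z : ℂ} (hz : z ∈ ball (0 : ℂ) 1) :
    HasDerivAt A (deriv A z) z :=
  (hA.differentiableOn.differentiableAt (isOpen_ball.mem_nhds hz)).hasDerivAt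

theorem continuousAt (hA : IsConcaveAtZero A) {z : ℂ} (hz : z ∈ ball (0 : ℂ) 1) :
    ContinuousAt A z :=
  (hA.hasDerivAt hz).continuousAt

/-- The function covers a neighborhood of infinity. -/
theorem exists_mem_image_of_norm_gt (hA : IsConcaveAtZero A) {r : ℝ} (hr : 0 < r) :
    ∃ M : ℝ, ∀ w : ℂ, M < ‖w‖ → w ∈ (fun z => A z / z) '' (ball 0 r \ {0}) := by
  have h0 : (0 : ℂ) ∈ ball (0 : ℂ) 1 := mem_ball_self one_pos
  have hAn : AnalyticAt ℂ A 0 := hA.differentiableOn.analyticAt (isOpen_ball.mem_nhds h0)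
  -- The reciprocal `z / A z` is a local homeomorphism at 0, so it covers a neighbourhood of 0.
  have han : AnalyticAt ℂ (fun z => z / A z) 0 := analyticAt_id.div hAn hA.ne_zero
  have hd : HasDerivAt (fun z => z / A z) ((1 * A 0 - 0 * deriv A 0) / A 0 ^ 2) 0 :=
    (hasDerivAt_id (0 : ℂ)).div (hA.hasDerivAt h0) hA.ne_zero
  have hs := han.hasStrictDerivAt
  rw [hd.deriv] at hs
  have hmap := hs.map_nhds_eq (by
    have := hA.ne_zero
    simp [this])
  simp only [zero_div] at hmap
  have him : (fun z => z / A z) '' ball 0 r ∈ 𝓝 (0 : ℂ) :=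
    hmap ▸ image_mem_map (ball_mem_nhds _ hr)
  obtain ⟨δ, hδ, hδs⟩ := Metric.mem_nhds_iff.1 him
  refine ⟨δ⁻¹, fun w hw => ?_⟩
  have hw0 : 0 < ‖w‖ := (inv_pos.2 hδ).trans hw
  obtain ⟨z, hz, hzw⟩ := hδs (show w⁻¹ ∈ ball (0 : ℂ) δ by
    rw [mem_ball_zero_iff, norm_inv]
    exact inv_lt_of_inv_lt₀ hδ hw)
  have hz0 : z ≠ 0 := by
    rintro rfl
    simp only at hzw
    rw [zero_div, eq_comm, inv_eq_zero] at hzw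
    rw [hzw, norm_zero] at hw0
    exact hw0.false
  refine ⟨z, ⟨hz, hz0⟩, ?_⟩
  simp only at hzw ⊢
  rw [← inv_div, hzw, inv_inv]

theorem isOpen_image (hA : IsConcaveAtZero A) :
    IsOpen ((fun z => A z / z) '' (ball 0 1 \ {0})) :=
  isOpen_image_of_injOn isOpen_puncturedDisc hA.differentiableOn_div hA.injOn
    isOpen_puncturedDisc Subset.rfl

theorem exists_norm_le_of_notMem_image (hA : IsConcaveAtZero A) :
    ∃ M : ℝ, 0 ≤ M ∧ ∀ w ∈ ((fun z => A z / z) '' (ball 0 1 \ {0}))ᶜ, ‖w‖ ≤ M := by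
  obtain ⟨M, hM⟩ := hA.exists_mem_image_of_norm_gt one_pos
  refine ⟨max M 0, le_max_right _ _, fun w hw => ?_⟩
  by_contra! h
  exact hw (hM w ((le_max_left _ _).trans_lt h))

theorem isCompact_compl (hA : IsConcaveAtZero A) :
    IsCompact ((fun z => A z / z) '' (ball 0 1 \ {0}))ᶜ := by
  obtain ⟨M, -, hM⟩ := hA.exists_norm_le_of_notMem_image
  exact (isCompact_closedBall (0 : ℂ) M).of_isClosed_subset hA.isOpen_image.isClosed_compl
    fun w hw => by simpa using hM w hw

theorem continuousOn_inv (hA : IsConcaveAtZero A) :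
    ContinuousOn (invFunOn (fun z => A z / z) (ball 0 1 \ {0}))
      ((fun z => A z / z) '' (ball 0 1 \ {0})) := by
  rintro _ ⟨z, hz, rfl⟩
  exact (hasDerivAt_invFunOn isOpen_puncturedDisc hA.differentiableOn_div hA.injOn
    hz).continuousAt.continuousWithinAt

/-- Near the unit circle, the values of the function are close to the complement of its range. -/
theorem exists_mem_thickening (hA : IsConcaveAtZero A) {δ : ℝ} (hδ : 0 < δ) :
    ∃ R < 1, ∀ z ∈ ball (0 : ℂ) 1 \ {0}, R ≤ ‖z‖ →
      A z / z ∈ thickening δ ((fun z => A z / z) '' (ball 0 1 \ {0}))ᶜ := by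
  set F : ℂ → ℂ := fun z => A z / z with hF
  set Φ := invFunOn F (ball 0 1 \ {0}) with hΦ
  obtain ⟨M, hM⟩ := hA.exists_mem_image_of_norm_gt (r := 1 / 2) (by norm_num)
  have hleft : ∀ z ∈ ball (0 : ℂ) 1 \ {0}, Φ (F z) = z := fun z hz =>
    hA.injOn.leftInvOn_invFunOn hz
  -- The bounded values at distance at least `δ` from the complement form a compact subset of the
  -- range, so their preimages lie in a disc of radius `m < 1`. Values larger than `M` are taken
  -- only in `‖z‖ < 1 / 2`.
  set W : Set ℂ := closedBall 0 M \ thickening δ (F '' (ball 0 1 \ {0}))ᶜ with hW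
  have hWc : IsCompact W := (isCompact_closedBall _ _).diff isOpen_thickening
  have hWs : W ⊆ F '' (ball 0 1 \ {0}) := by
    intro w hw
    by_contra h
    exact hw.2 (self_subset_thickening hδ _ h)
  have key : ∃ m < 1, ∀ w ∈ W, ‖Φ w‖ ≤ m := by
    rcases W.eq_empty_or_nonempty with h | h
    · exact ⟨0, one_pos, by simp [h]⟩
    · obtain ⟨w, hw, hmax⟩ := hWc.exists_isMaxOn h ((hA.continuousOn_inv.mono hWs).norm)
      refine ⟨‖Φ w‖, ?_, fun v hv => hmax hv⟩
      obtain ⟨z, hz, rfl⟩ := hWs hw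
      rw [hleft z hz]
      simpa using hz.1
  obtain ⟨m, hm1, hm⟩ := key
  refine ⟨max (1 / 2) ((1 + m) / 2), max_lt (by norm_num) (by linarith), fun z hz hzR => ?_⟩
  by_contra hcon
  by_cases hn : M < ‖F z‖
  · obtain ⟨y, hy, hyz⟩ := hM _ hn
    have hyb : y ∈ ball (0 : ℂ) 1 \ {0} := ⟨ball_subset_ball (by norm_num) hy.1, hy.2⟩
    rw [hA.injOn hyb hz hyz] at hy
    have := (le_max_left _ _).trans hzR
    have h2 := mem_ball_zero_iff.1 hy.1
    linarith
  · have := hm (F z) ⟨by simpa using hn, hcon⟩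
    rw [hleft z hz] at this
    have h2 := (le_max_right _ _).trans hzR
    linarith

/-- Near 0 the values exceed `M + 1`, where `M` bounds the complement. The remaining closed annulus
has compact image disjoint from the closed complement, hence at positive distance from it. -/
theorem exists_notMem_thickening_of_norm_le (hA : IsConcaveAtZero A) {ρ : ℝ} (hρ : ρ < 1) :
    ∃ δ > 0, ∀ η ∈ ball (0 : ℂ) 1 \ {0}, ‖η‖ ≤ ρ →
      A η / η ∉ thickening δ ((fun z => A z / z) '' (ball 0 1 \ {0}))ᶜ := by
  set F : ℂ → ℂ := fun z => A z / z with hF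
  obtain ⟨M, hM0, hM⟩ := hA.exists_norm_le_of_notMem_image
  have h0 : (0 : ℂ) ∈ ball (0 : ℂ) 1 := mem_ball_self one_pos
  have hev : ∀ᶠ z in 𝓝 (0 : ℂ), (M + 1) * ‖z‖ < ‖A z‖ := by
    have h1 : ContinuousAt (fun z : ℂ => (M + 1) * ‖z‖) 0 := by fun_prop
    refine Filter.Tendsto.eventually_lt h1 (hA.continuousAt h0).norm ?_
    simpa using hA.ne_zero
  obtain ⟨r, hr, hrs⟩ := Metric.eventually_nhds_iff_ball.1 hev
  set T : Set ℂ := closedBall 0 ρ \ ball 0 r with hT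
  have hTs : T ⊆ ball (0 : ℂ) 1 \ {0} := fun z hz =>
    ⟨closedBall_subset_ball hρ hz.1, fun h => hz.2 (by rw [h]; exact mem_ball_self hr)⟩
  have hTc : IsCompact (F '' T) :=
    ((isCompact_closedBall _ _).diff isOpen_ball).image_of_continuousOn
      (hA.differentiableOn_div.continuousOn.mono hTs)
  have hdisj : Disjoint (F '' T) (F '' (ball 0 1 \ {0}))ᶜ :=
    disjoint_compl_right.mono_left (image_mono hTs)
  obtain ⟨δ, hδ, hd⟩ := hdisj.exists_thickenings hTc hA.isCompact_compl.isClosed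
  refine ⟨min δ 1, lt_min hδ one_pos, fun η hη hηρ hmem => ?_⟩
  by_cases hηr : ‖η‖ < r
  · obtain ⟨w, hw, hdist⟩ := mem_thickening_iff.1 hmem
    have h1 := hrs η (by simpa using hηr)
    have hη0 : 0 < ‖η‖ := norm_pos_iff.2 hη.2
    have h2 : M + 1 < ‖F η‖ := by
      rw [hF]
      simp only
      rwa [norm_div, lt_div_iff₀ hη0]
    have h3 := hM w hw
    have h4 : ‖F η‖ ≤ ‖w‖ + dist (F η) w := by
      rw [dist_eq_norm]
      calc ‖F η‖ = ‖w + (F η - w)‖ := by ring_nf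
        _ ≤ _ := norm_add_le _ _
    have h5 := hdist.trans_le (min_le_right _ _)
    linarith
  · refine disjoint_left.1 hd (self_subset_thickening hδ _ (mem_image_of_mem F
      (show η ∈ T from ⟨by simpa using hηρ, by simpa using hηr⟩))) ?_
    exact thickening_mono (min_le_left _ _) _ hmem

/-- The images of the discs `‖z‖ < r` have convex complements, too. -/
theorem norm_le_of_eq_add (hA : IsConcaveAtZero A) {x z η : ℂ} {t : ℝ} (hx : ‖x‖ = 1)
    (ht : t ∈ Icc (0 : ℝ) 1) (hz : z ∈ ball (0 : ℂ) 1 \ {0}) (hη : η ∈ ball (0 : ℂ) 1 \ {0})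
    (h : A η / η = t * (A (x * z) / (x * z)) + (1 - t) * (A z / z)) : ‖z‖ ≤ ‖η‖ := by
  set F : ℂ → ℂ := fun z => A z / z with hF
  set Φ := invFunOn F (ball 0 1 \ {0}) with hΦ
  have hx0 : x ≠ 0 := by rintro rfl; simp at hx
  have hleft : ∀ z ∈ ball (0 : ℂ) 1 \ {0}, Φ (F z) = z := fun z hz =>
    hA.injOn.leftInvOn_invFunOn hz
  -- With `Φ` the inverse of `F`, the claim is `‖y / Φ (g y)‖ ≤ 1` at `y = z`, to be obtained from
  -- the maximum principle on the open set `U` of points where `Φ (g y)` makes sense.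
  set g : ℂ → ℂ := fun z => t * F (x * z) + (1 - t) * F z with hg
  have hxz : ∀ z ∈ ball (0 : ℂ) 1 \ {0}, x * z ∈ ball (0 : ℂ) 1 \ {0} := fun z hz =>
    ⟨by rw [mem_ball_zero_iff, norm_mul, hx, one_mul]; simpa using hz.1, mul_ne_zero hx0 hz.2⟩
  have hgd : DifferentiableOn ℂ g (ball 0 1 \ {0}) := by
    have h1 : DifferentiableOn ℂ (fun z => F (x * z)) (ball 0 1 \ {0}) :=
      hA.differentiableOn_div.comp (by fun_prop) hxz
    have h2 := hA.differentiableOn_div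
    exact (h1.const_mul _).add (h2.const_mul _)
  set U : Set ℂ := (ball (0 : ℂ) 1 \ {0}) ∩ g ⁻¹' (F '' (ball 0 1 \ {0})) with hU
  have hUo : IsOpen U := hgd.continuousOn.isOpen_inter_preimage isOpen_puncturedDisc hA.isOpen_image
  have hΦU : ∀ y ∈ U, Φ (g y) ∈ ball (0 : ℂ) 1 \ {0} ∧ F (Φ (g y)) = g y := fun y hy =>
    ⟨invFunOn_mem hy.2, invFunOn_eq hy.2⟩
  have hud : DifferentiableOn ℂ (fun y => y / Φ (g y)) U := by
    intro y hy
    have h1 : DifferentiableAt ℂ g y := hgd.differentiableAt (isOpen_puncturedDisc.mem_nhds hy.1)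
    have h2 : DifferentiableAt ℂ Φ (g y) := by
      obtain ⟨v, hv, hvy⟩ := hy.2
      rw [← hvy]
      exact (hasDerivAt_invFunOn isOpen_puncturedDisc hA.differentiableOn_div hA.injOn
        hv).differentiableAt
    exact (differentiableAt_id.div (h2.comp y h1) (hΦU y hy).1.2).differentiableWithinAt
  have hzU : z ∈ U := ⟨hz, η, hη, h⟩
  have hmain := norm_le_one_of_superlevel_subset_compact hUo
    (isBounded_ball.subset (inter_subset_left.trans sdiff_subset)) hud ?_ z hzU
  · have h1 : Φ (g z) = η := by
      rw [← hleft η hη]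
      exact congrArg Φ h.symm
    rw [h1, norm_div, div_le_one (norm_pos_iff.2 hη.2)] at hmain
    exact hmain
  intro ε hε
  have h0 : (0 : ℂ) ∈ ball (0 : ℂ) 1 := mem_ball_self one_pos
  -- `G y = y * g y` is regular at 0, and `y / Φ (g y)` equals `G y / A (Φ (g y))` there; its
  -- limiting modulus at 0 is `‖G 0‖ / ‖A 0‖ ≤ 1`.
  set G : ℂ → ℂ := fun y => t * (A (x * y) / x) + (1 - t) * A y with hG
  have hGg : ∀ y ≠ 0, G y = y * g y := fun y hy => by
    simp only [hG, hg, hF]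
    field_simp
  have hGc : ContinuousOn G (ball 0 1) := by
    have hc := hA.differentiableOn.continuousOn
    have h1 : ContinuousOn (fun y => A (x * y)) (ball 0 1) :=
      hc.comp (by fun_prop) fun y hy => by
        rw [mem_ball_zero_iff, norm_mul, hx, one_mul]; simpa using hy
    exact (continuousOn_const.mul (h1.div_const x)).add (continuousOn_const.mul hc)
  have hG0 : ‖G 0‖ ≤ ‖A 0‖ := by
    have : ‖G 0‖ ≤ ‖(t : ℂ) * (A 0 / x)‖ + ‖(1 - t : ℂ) * A 0‖ := by
      simp only [hG, mul_zero]
      exact norm_add_le _ _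
    have e1 : ‖(1 - t : ℂ)‖ = 1 - t := by
      rw [← Complex.ofReal_one, ← Complex.ofReal_sub, Complex.norm_real,
        Real.norm_of_nonneg (by linarith [ht.2])]
    rw [norm_mul, norm_mul, norm_div, hx, div_one, e1, Complex.norm_real,
      Real.norm_of_nonneg ht.1] at this
    linarith
  have hnear : ∃ r > 0, r < 1 ∧ ∀ y ∈ ball (0 : ℂ) r, ∀ v ∈ ball (0 : ℂ) r,
      ‖G y‖ < (1 + ε) * ‖A v‖ := by
    have hApos : 0 < ‖A 0‖ := norm_pos_iff.2 hA.ne_zero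
    set s := ‖A 0‖ * (1 + ε / 2) / (1 + ε) with hs
    have hs1 : s < ‖A 0‖ := by
      rw [hs, div_lt_iff₀ (by positivity)]
      nlinarith
    have hs2 : ‖G 0‖ < (1 + ε) * s := by
      rw [hs, mul_div_cancel₀ _ (by positivity)]
      nlinarith
    have e1 : ∀ᶠ y in 𝓝 (0 : ℂ), ‖G y‖ < (1 + ε) * s :=
      (hGc.continuousAt (isOpen_ball.mem_nhds h0)).norm.eventually_lt_const hs2
    have e2 : ∀ᶠ y in 𝓝 (0 : ℂ), s < ‖A y‖ := (hA.continuousAt h0).norm.eventually_const_lt hs1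
    obtain ⟨r, hr, hrs⟩ := Metric.eventually_nhds_iff_ball.1 (e1.and e2)
    refine ⟨min r (1 / 2), by positivity, by
      exact (min_le_right _ _).trans_lt (by norm_num), fun y hy v hv => ?_⟩
    refine (hrs y (ball_subset_ball (min_le_left _ _) hy)).1.trans ?_
    gcongr
    exact (hrs v (ball_subset_ball (min_le_left _ _) hv)).2
  obtain ⟨r, hr, hr1, hrs⟩ := hnear
  set ρ := 1 / (1 + ε) with hρ
  have hρ1 : ρ < 1 := by
    rw [hρ, div_lt_one (by positivity)]
    linarith
  obtain ⟨δ, hδ, hδs⟩ := hA.exists_notMem_thickening_of_norm_le hρ1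
  obtain ⟨R, hR1, hRs⟩ := hA.exists_mem_thickening hδ
  -- The superlevel set is controlled through pairs `(y, v)` with `v = Φ (g y)`. The equation `F v =
  -- g y` is written as `y * A v = v * G y`, without denominators, so that it is a closed condition
  -- and `K2` is compact; its projection automatically lies in `U`.
  set K2 : Set (ℂ × ℂ) := ((closedBall (0 : ℂ) R \ ball 0 r) ×ˢ closedBall (0 : ℂ) ρ) ∩
    {q | (1 + ε) * ‖q.2‖ ≤ ‖q.1‖} ∩ {q | q.1 * A q.2 - q.2 * G q.1 = 0} with hK2
  have hK2c : IsCompact K2 := by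
    have hc1 : IsCompact ((closedBall (0 : ℂ) R \ ball 0 r) ×ˢ closedBall (0 : ℂ) ρ) :=
      ((isCompact_closedBall _ _).diff isOpen_ball).prod (isCompact_closedBall _ _)
    have hc2 : IsCompact (((closedBall (0 : ℂ) R \ ball 0 r) ×ˢ closedBall (0 : ℂ) ρ) ∩
        {q | (1 + ε) * ‖q.2‖ ≤ ‖q.1‖}) :=
      hc1.inter_right (isClosed_le (by fun_prop) (by fun_prop))
    refine hc2.of_isClosed_subset ?_ inter_subset_left
    refine ContinuousOn.preimage_isClosed_of_isClosed (f := fun q : ℂ × ℂ =>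
      q.1 * A q.2 - q.2 * G q.1) (t := {0}) ?_ hc2.isClosed isClosed_singleton
    have hc3 : ContinuousOn (fun q : ℂ × ℂ => A q.2) (((closedBall (0 : ℂ) R \ ball 0 r) ×ˢ
        closedBall (0 : ℂ) ρ) ∩ {q | (1 + ε) * ‖q.2‖ ≤ ‖q.1‖}) :=
      hA.differentiableOn.continuousOn.comp continuousOn_snd fun q hq =>
        closedBall_subset_ball hρ1 hq.1.2
    have hc4 : ContinuousOn (fun q : ℂ × ℂ => G q.1) (((closedBall (0 : ℂ) R \ ball 0 r) ×ˢ
        closedBall (0 : ℂ) ρ) ∩ {q | (1 + ε) * ‖q.2‖ ≤ ‖q.1‖}) :=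
      hGc.comp continuousOn_fst fun q hq => closedBall_subset_ball hR1 hq.1.1.1
    exact (continuousOn_fst.mul hc3).sub (continuousOn_snd.mul hc4)
  refine ⟨Prod.fst '' K2, ?_, hK2c.image continuous_fst, ?_⟩
  · rintro _ ⟨⟨y, v⟩, ⟨⟨⟨⟨hy1, hy2⟩, hv⟩, hyv⟩, he⟩, rfl⟩
    simp only [mem_ofPred_eq] at hyv he hy2 hy1 hv ⊢
    have hyb : y ∈ ball (0 : ℂ) 1 := closedBall_subset_ball hR1 hy1
    have hvb : v ∈ ball (0 : ℂ) 1 := closedBall_subset_ball hρ1 hv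
    have hy0 : y ≠ 0 := by rintro rfl; exact hy2 (mem_ball_self hr)
    have hv0 : v ≠ 0 := by
      rintro rfl
      rw [zero_mul, sub_zero] at he
      exact (mul_ne_zero hy0 hA.ne_zero) he
    refine ⟨⟨hyb, hy0⟩, v, ⟨hvb, hv0⟩, ?_⟩
    rw [hGg y hy0] at he
    simp only [hF]
    rw [div_eq_iff hv0]
    apply mul_left_cancel₀ hy0
    linear_combination he
  · intro y hy hle
    obtain ⟨hv, hFv⟩ := hΦU y hy
    set v := Φ (g y) with hvdef
    have hv0 : 0 < ‖v‖ := norm_pos_iff.2 hv.2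
    have hyb : ‖y‖ < 1 := by simpa using hy.1.1
    rw [norm_div, le_div_iff₀ hv0] at hle
    have hvy : ‖v‖ ≤ ‖y‖ := by nlinarith
    have hvρ : ‖v‖ ≤ ρ := by
      rw [hρ, le_div_iff₀ (by positivity)]
      linarith
    have he : y * A v = v * G y := by
      rw [hGg y hy.1.2, ← hFv, hF]
      simp only
      have := hv.2
      rw [mem_singleton_iff] at this
      field_simp
    refine ⟨(y, v), ⟨⟨⟨⟨?_, ?_⟩, by simpa using hvρ⟩, hle⟩, sub_eq_zero.2 he⟩, rfl⟩
    · rw [mem_closedBall_zero_iff]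
      by_contra! hlt
      have hm1 := hRs y hy.1 hlt.le
      have hm2 := hRs (x * y) (hxz y hy.1) (by rw [norm_mul, hx, one_mul]; exact hlt.le)
      -- Convexity enters here: for `y` near the unit circle, `F y` and `F (x * y)` are `δ`-close to
      -- the complement, hence so is `g y`. This is impossible for a value of `F` at `v` with `‖v‖ ≤
      -- ρ`.
      have := (hA.convex.thickening δ) hm2 hm1 ht.1 (sub_nonneg.2 ht.2) (by ring)
      refine hδs v hv hvρ ?_
      change F v ∈ _
      rw [hFv]
      convert this using 1
      simp [hg, hF]
    · intro hyr
      have hvr : v ∈ ball (0 : ℂ) r := by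
        rw [mem_ball_zero_iff] at hyr ⊢
        exact hvy.trans_lt hyr
      have h1 := hrs y hyr v hvr
      have h2 : ‖y‖ * ‖A v‖ = ‖v‖ * ‖G y‖ := by rw [← norm_mul, he, norm_mul]
      have h3 : ‖v‖ * ‖G y‖ < ‖v‖ * ((1 + ε) * ‖A v‖) := by gcongr
      have h4 : (1 + ε) * ‖v‖ * ‖A v‖ ≤ ‖y‖ * ‖A v‖ := by gcongr
      nlinarith

end IsConcaveAtZero

end PoleAtZero

/-! ### The two-point inequality and its coefficient consequences -/

section TwoPoint

/-- With `F z = A z / z`, this is `-2 z F'(z) / (F z - F ζ) + (z + ζ) / (z - ζ)`. -/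
def twoPoint (A : ℂ → ℂ) (z ζ : ℂ) : ℂ :=
  -2 * ζ * (z * deriv A z - A z) / (ζ * A z - z * A ζ) + (z + ζ) / (z - ζ)

/-- Taylor expansion of order two at the origin with holomorphic remainder. -/
theorem exists_taylor_two {A : ℂ → ℂ} (hA : DifferentiableOn ℂ A (ball 0 1)) :
    ∃ b c : ℂ, ∃ R : ℂ → ℂ, DifferentiableOn ℂ R (ball 0 1) ∧
      ∀ z, A z = A 0 + b * z + c * z ^ 2 + z ^ 3 * R z := by
  have h0 : ball (0 : ℂ) 1 ∈ 𝓝 (0 : ℂ) := ball_mem_nhds _ one_pos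
  set A₁ := dslope A 0 with h1
  set A₂ := dslope A₁ 0 with h2
  set A₃ := dslope A₂ 0 with h3
  refine ⟨A₁ 0, A₂ 0, A₃, ?_, fun z => ?_⟩
  · rw [h3, Complex.differentiableOn_dslope h0, h2, Complex.differentiableOn_dslope h0, h1,
      Complex.differentiableOn_dslope h0]
    exact hA
  · have e1 := sub_smul_dslope A 0 z
    have e2 := sub_smul_dslope A₁ 0 z
    have e3 := sub_smul_dslope A₂ 0 z
    simp only [sub_zero, smul_eq_mul, ← h1, ← h2, ← h3] at e1 e2 e3
    linear_combination -e1 - z * e2 - z ^ 2 * e3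

/-- Because of this, the summand that removes the pole of `twoPoint` on the diagonal does not affect
its real part on `‖z‖ = ‖ζ‖`. -/
theorem re_div_eq_zero_of_norm_eq {z ζ : ℂ} (h : ‖z‖ = ‖ζ‖) : ((z + ζ) / (z - ζ)).re = 0 := by
  have h2 : Complex.normSq z = Complex.normSq ζ := by
    rw [← Complex.sq_norm, ← Complex.sq_norm, h]
  rw [Complex.normSq_apply, Complex.normSq_apply] at h2
  rw [Complex.div_re, ← add_div]
  have : (z + ζ).re * (z - ζ).re + (z + ζ).im * (z - ζ).im = 0 := by
    simp only [Complex.add_re, Complex.sub_re, Complex.add_im, Complex.sub_im]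
    linear_combination h2
  rw [this, zero_div]

namespace IsConcaveAtZero

variable {A : ℂ → ℂ}

theorem hasDerivAt_div (hA : IsConcaveAtZero A) {z : ℂ} (hz : z ∈ ball (0 : ℂ) 1 \ {0}) :
    HasDerivAt (fun z => A z / z) ((z * deriv A z - A z) / z ^ 2) z := by
  exact ((hA.hasDerivAt hz.1).div (hasDerivAt_id' z) hz.2).congr_deriv (by ring)

theorem mul_deriv_sub_ne_zero (hA : IsConcaveAtZero A) {z : ℂ} (hz : z ∈ ball (0 : ℂ) 1) :
    z * deriv A z - A z ≠ 0 := by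
  by_cases hz0 : z = 0
  · subst hz0
    simpa using hA.ne_zero
  · have h1 : z ∈ ball (0 : ℂ) 1 \ {0} := ⟨hz, hz0⟩
    have := deriv_ne_zero_of_injOn isOpen_puncturedDisc hA.differentiableOn_div hA.injOn h1
    rw [(hA.hasDerivAt_div h1).deriv] at this
    exact fun h => this (by rw [h, zero_div])

theorem mul_sub_mul_ne_zero (hA : IsConcaveAtZero A) {z ζ : ℂ} (hz : z ∈ ball (0 : ℂ) 1)
    (hζ : ζ ∈ ball (0 : ℂ) 1) (hne : z ≠ ζ) : ζ * A z - z * A ζ ≠ 0 := by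
  intro h
  by_cases hz0 : z = 0
  · subst hz0
    rw [zero_mul, sub_zero] at h
    exact (mul_ne_zero hne.symm hA.ne_zero) h
  by_cases hζ0 : ζ = 0
  · subst hζ0
    rw [zero_mul, zero_sub, neg_eq_zero] at h
    exact (mul_ne_zero hz0 hA.ne_zero) h
  refine hne (hA.injOn ⟨hz, hz0⟩ ⟨hζ, hζ0⟩ ?_)
  simp only
  rw [div_eq_div_iff hz0 hζ0]
  linear_combination h

/-- For points of equal modulus, the direction from `F z` to `F ζ` points out of the image of the
disc of radius `‖z‖` around the origin. -/
theorem re_div_nonneg (hA : IsConcaveAtZero A) {z ζ : ℂ} (hz : z ∈ ball (0 : ℂ) 1 \ {0})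
    (hζ : ζ ∈ ball (0 : ℂ) 1 \ {0}) (hn : ‖z‖ = ‖ζ‖) :
    0 ≤ ((A ζ / ζ - A z / z) / (z * ((z * deriv A z - A z) / z ^ 2))).re := by
  set F : ℂ → ℂ := fun z => A z / z with hF
  set Φ := invFunOn F (ball 0 1 \ {0}) with hΦ
  set D := (z * deriv A z - A z) / z ^ 2 with hD
  have hleft : Φ (F z) = z := hA.injOn.leftInvOn_invFunOn hz
  have hz0 : z ≠ 0 := hz.2
  have hD0 : D ≠ 0 := div_ne_zero (hA.mul_deriv_sub_ne_zero hz.1) (pow_ne_zero 2 hz0)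
  set d := F ζ - F z with hd
  have hΦd : HasDerivAt Φ D⁻¹ (F z) := by
    rw [hD, ← (hA.hasDerivAt_div hz).deriv]
    exact hasDerivAt_invFunOn isOpen_puncturedDisc hA.differentiableOn_div hA.injOn hz
  have hline : HasDerivAt (fun τ : ℂ => F z + τ * d) d 0 := by
    simpa using ((hasDerivAt_id (0 : ℂ)).mul_const d).const_add (F z)
  have hη : HasDerivAt (fun τ : ℂ => Φ (F z + τ * d)) (D⁻¹ * d) ((0 : ℝ) : ℂ) := by
    rw [Complex.ofReal_zero]
    exact HasDerivAt.comp (0 : ℂ) (h₂ := Φ) (by simpa using hΦd) hline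
  -- Along the segment from `F z` towards `F ζ` the modulus of the preimage never falls below its
  -- initial value `‖z‖`, so the right derivative of its square at `t = 0` is nonnegative.
  have hsq := hη.comp_ofReal.norm_sq
  have hev : ∀ᶠ t : ℝ in 𝓝[>] 0, ‖z‖ ≤ ‖Φ (F z + t * d)‖ := by
    have hcont : Continuous fun t : ℝ => F z + t * d := by fun_prop
    have h1 : ∀ᶠ t : ℝ in 𝓝 0, F z + t * d ∈ F '' (ball 0 1 \ {0}) := by
      refine (hcont.tendsto 0).eventually (hA.isOpen_image.mem_nhds ?_)
      simpa using mem_image_of_mem F hz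
    have h2 : ∀ᶠ t : ℝ in 𝓝 0, t < 1 := gt_mem_nhds one_pos
    filter_upwards [eventually_nhdsWithin_of_eventually_nhds h1,
      eventually_nhdsWithin_of_eventually_nhds h2, self_mem_nhdsWithin] with t ht ht1 ht0
    have hx : ‖ζ / z‖ = 1 := by rw [norm_div, hn, div_self (norm_ne_zero_iff.2 hζ.2)]
    refine hA.norm_le_of_eq_add (t := t) hx ⟨le_of_lt ht0, ht1.le⟩ hz (invFunOn_mem ht) ?_
    have := invFunOn_eq ht
    rw [div_mul_cancel₀ _ hz0]
    change F (Φ _) = t * F ζ + (1 - t) * F z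
    rw [this, hd]
    ring
  have hslope := hsq.tendsto_slope_zero_right
  have hnonneg : 0 ≤ 2 * inner ℝ (Φ (F z + ((0 : ℝ) : ℂ) * d)) (D⁻¹ * d) := by
    refine ge_of_tendsto hslope ?_
    filter_upwards [hev, self_mem_nhdsWithin] with t ht ht0
    have ht0' : (0 : ℝ) < t := ht0
    rw [zero_add, smul_eq_mul]
    refine mul_nonneg (inv_nonneg.2 ht0'.le) (sub_nonneg.2 ?_)
    simp only [Complex.ofReal_zero, zero_mul, add_zero, hleft]
    gcongr
  rw [Complex.ofReal_zero, zero_mul, add_zero, hleft, Complex.inner] at hnonneg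
  have e1 : d / (z * D) = ((starRingEnd ℂ) z * (D⁻¹ * d)) / ((‖z‖ ^ 2 : ℝ) : ℂ) := by
    rw [Complex.ofReal_pow, ← Complex.conj_mul']
    have hc : (starRingEnd ℂ) z ≠ 0 := by simpa using hz0
    field_simp
  change 0 ≤ (d / (z * D)).re
  rw [e1, Complex.div_ofReal_re]
  have hmul : D⁻¹ * d * (starRingEnd ℂ) z = (starRingEnd ℂ) z * (D⁻¹ * d) := mul_comm _ _
  rw [hmul] at hnonneg
  exact div_nonneg (by linarith) (by positivity)

/-- The first summand is `2 / Q` with `Q` the quotient of `re_div_nonneg`, and inversion preserves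
the sign of the real part. -/
theorem re_twoPoint_nonneg (hA : IsConcaveAtZero A) {z ζ : ℂ} (hz : z ∈ ball (0 : ℂ) 1 \ {0})
    (hζ : ζ ∈ ball (0 : ℂ) 1 \ {0}) (hn : ‖z‖ = ‖ζ‖) (hne : z ≠ ζ) :
    0 ≤ (twoPoint A z ζ).re := by
  have h := hA.re_div_nonneg hz hζ hn
  set Q := (A ζ / ζ - A z / z) / (z * ((z * deriv A z - A z) / z ^ 2)) with hQ
  have hz0 : z ≠ 0 := hz.2
  have hζ0 : ζ ≠ 0 := hζ.2
  have e : twoPoint A z ζ = 2 * Q⁻¹ + (z + ζ) / (z - ζ) := by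
    rw [twoPoint, hQ]
    congr 1
    have h1 := hA.mul_deriv_sub_ne_zero hz.1
    have h2 := hA.mul_sub_mul_ne_zero hz.1 hζ.1 hne
    have h3 : A ζ / ζ - A z / z = -(ζ * A z - z * A ζ) / (z * ζ) := by
      field_simp
      ring
    rw [h3, inv_div]
    field_simp
  rw [e, Complex.add_re, re_div_eq_zero_of_norm_eq hn, add_zero, Complex.mul_re, Complex.inv_re]
  simp only [Complex.re_ofNat, Complex.im_ofNat, zero_mul, sub_zero]
  exact mul_nonneg zero_le_two (div_nonneg h (Complex.normSq_nonneg _))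

theorem differentiableOn_deriv (hA : IsConcaveAtZero A) :
    DifferentiableOn ℂ (deriv A) (ball 0 1) :=
  hA.differentiableOn.deriv isOpen_ball

theorem differentiableOn_twoPoint_left (hA : IsConcaveAtZero A) {a : ℂ}
    (ha : a ∈ ball (0 : ℂ) 1) :
    DifferentiableOn ℂ (fun z => twoPoint A z a) (ball 0 1 \ {a}) := by
  have h1 : DifferentiableOn ℂ A (ball 0 1 \ {a}) := hA.differentiableOn.mono sdiff_subset
  have h2 : DifferentiableOn ℂ (deriv A) (ball 0 1 \ {a}) :=
    hA.differentiableOn_deriv.mono sdiff_subset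
  have h3 : ∀ z ∈ ball (0 : ℂ) 1 \ {a}, z - a ≠ 0 := fun z hz => sub_ne_zero.2 hz.2
  have h4 : ∀ z ∈ ball (0 : ℂ) 1 \ {a}, a * A z - z * A a ≠ 0 := fun z hz =>
    hA.mul_sub_mul_ne_zero hz.1 ha hz.2
  simp only [twoPoint]
  fun_prop (disch := assumption)

theorem differentiableOn_twoPoint_right (hA : IsConcaveAtZero A) {a : ℂ}
    (ha : a ∈ ball (0 : ℂ) 1) :
    DifferentiableOn ℂ (fun ζ => twoPoint A a ζ) (ball 0 1 \ {a}) := by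
  have h1 : DifferentiableOn ℂ A (ball 0 1 \ {a}) := hA.differentiableOn.mono sdiff_subset
  have h3 : ∀ z ∈ ball (0 : ℂ) 1 \ {a}, a - z ≠ 0 := fun z hz => sub_ne_zero.2 (Ne.symm hz.2)
  have h4 : ∀ z ∈ ball (0 : ℂ) 1 \ {a}, z * A a - a * A z ≠ 0 := fun z hz =>
    hA.mul_sub_mul_ne_zero ha hz.1 (Ne.symm hz.2)
  simp only [twoPoint]
  fun_prop (disch := assumption)

/-- The two summands have residues `-2a` and `2a` at `z = a`, so the singularity on the diagonal is
removable. -/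
theorem tendsto_twoPoint_left (hA : IsConcaveAtZero A) {a : ℂ} (ha : a ∈ ball (0 : ℂ) 1) :
    Tendsto (fun z => (z - a) * twoPoint A z a) (𝓝[≠] a) (𝓝 0) := by
  have hB : HasDerivAt (fun z => a * A z - z * A a) (a * deriv A a - 1 * A a) a :=
    ((hA.hasDerivAt ha).const_mul a).sub ((hasDerivAt_id a).mul_const (A a))
  rw [one_mul] at hB
  have hs := hB.tendsto_slope
  have hne := hA.mul_deriv_sub_ne_zero ha
  have hcA : ContinuousAt A a := hA.continuousAt ha
  have hcA' : ContinuousAt (deriv A) a :=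
    hA.differentiableOn_deriv.continuousOn.continuousAt (isOpen_ball.mem_nhds ha)
  have hnum : Tendsto (fun z => -2 * a * (z * deriv A z - A z)) (𝓝[≠] a)
      (𝓝 (-2 * a * (a * deriv A a - A a))) := by
    have : ContinuousAt (fun z => -2 * a * (z * deriv A z - A z)) a := by fun_prop
    exact this.tendsto.mono_left nhdsWithin_le_nhds
  have hadd : Tendsto (fun z => z + a) (𝓝[≠] a) (𝓝 (a + a)) := by
    have : ContinuousAt (fun z : ℂ => z + a) a := by fun_prop
    exact this.tendsto.mono_left nhdsWithin_le_nhds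
  have := (hnum.div hs hne).add hadd
  rw [mul_div_cancel_right₀ _ hne, show -2 * a + (a + a) = 0 by ring] at this
  refine this.congr' ?_
  filter_upwards [self_mem_nhdsWithin] with z hz
  have hza : z - a ≠ 0 := sub_ne_zero.2 hz
  rw [Pi.div_apply, slope_def_field, twoPoint, mul_add, mul_div_cancel₀ _ hza, sub_self, sub_zero,
    div_div_eq_mul_div]
  ring

theorem tendsto_twoPoint_right (hA : IsConcaveAtZero A) {a : ℂ} (ha : a ∈ ball (0 : ℂ) 1) :
    Tendsto (fun ζ => (ζ - a) * twoPoint A a ζ) (𝓝[≠] a) (𝓝 0) := by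
  have hB : HasDerivAt (fun z => z * A a - a * A z) (1 * A a - a * deriv A a) a :=
    ((hasDerivAt_id a).mul_const (A a)).sub ((hA.hasDerivAt ha).const_mul a)
  rw [one_mul, ← neg_sub] at hB
  have hs := hB.tendsto_slope
  have hne := hA.mul_deriv_sub_ne_zero ha
  have hnum : Tendsto (fun ζ => -2 * ζ * (a * deriv A a - A a)) (𝓝[≠] a)
      (𝓝 (-2 * a * (a * deriv A a - A a))) := by
    have : ContinuousAt (fun ζ => -2 * ζ * (a * deriv A a - A a)) a := by fun_prop
    exact this.tendsto.mono_left nhdsWithin_le_nhds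
  have hadd : Tendsto (fun z => z + a) (𝓝[≠] a) (𝓝 (a + a)) := by
    have : ContinuousAt (fun z : ℂ => z + a) a := by fun_prop
    exact this.tendsto.mono_left nhdsWithin_le_nhds
  have := (hnum.div hs (neg_ne_zero.2 hne)).sub hadd
  rw [div_neg, mul_div_cancel_right₀ _ hne, show -(-2 * a) - (a + a) = 0 by ring] at this
  refine this.congr' ?_
  filter_upwards [self_mem_nhdsWithin] with z hz
  have hza : z - a ≠ 0 := sub_ne_zero.2 hz
  have hza' : a - z ≠ 0 := sub_ne_zero.2 (Ne.symm hz)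
  have e : (z - a) * ((a + z) / (a - z)) = -(z + a) := by
    rw [← neg_sub a z]
    field_simp
    ring
  rw [Pi.div_apply, slope_def_field, twoPoint, mul_add, e, sub_self, sub_zero,
    div_div_eq_mul_div]
  ring

theorem twoPoint_zero_left (hA : IsConcaveAtZero A) {ζ : ℂ} (hζ : ζ ≠ 0) :
    twoPoint A 0 ζ = 1 := by
  have := hA.ne_zero
  rw [twoPoint]
  field_simp
  ring

theorem twoPoint_zero_right {z : ℂ} (hz : z ≠ 0) : twoPoint A z 0 = 1 := by
  rw [twoPoint]
  simp [hz]

/-- Schwarz lemma in `z` on the disc of radius `‖ζ‖`, with boundary values in the right half-plane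
and value 1 at the origin. -/
theorem norm_twoPoint_sub_one_le_of_norm_le (hA : IsConcaveAtZero A) {z ζ : ℂ}
    (hζ : ζ ∈ ball (0 : ℂ) 1 \ {0}) (hn : ‖z‖ ≤ ‖ζ‖) (hne : z ≠ ζ) :
    ‖twoPoint A z ζ - 1‖ ≤ ‖z‖ / ‖ζ‖ * ‖twoPoint A z ζ + 1‖ := by
  have hr : 0 < ‖ζ‖ := norm_pos_iff.2 hζ.2
  have hr1 : ‖ζ‖ < 1 := by simpa using hζ.1
  have := norm_sub_one_le_of_sphere (M := 1) hr hr1 hζ.1 hζ.2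
    (hA.differentiableOn_twoPoint_left hζ.1) (hA.tendsto_twoPoint_left hζ.1)
    (hA.twoPoint_zero_left hζ.2) le_rfl (fun w hw hwne => ?_) hn hne
  · rwa [one_mul] at this
  · rw [one_mul, norm_sub_one_le_norm_add_one_iff]
    have hw' := mem_sphere_zero_iff_norm.1 hw
    refine hA.re_twoPoint_nonneg ⟨?_, ?_⟩ hζ hw' hwne
    · rw [mem_ball_zero_iff, hw']; exact hr1
    · exact norm_pos_iff.1 (hw' ▸ hr)

/-- A second Schwarz lemma, now in `ζ`: on the circle `‖ζ‖ = r > ‖z‖` the previous estimate supplies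
`M = ‖z‖ / r`, and then `r → 1`. -/
theorem norm_twoPoint_sub_one_le (hA : IsConcaveAtZero A) {z ζ : ℂ}
    (hz : z ∈ ball (0 : ℂ) 1 \ {0}) (hζ : ζ ∈ ball (0 : ℂ) 1) (hne : z ≠ ζ) :
    ‖twoPoint A z ζ - 1‖ ≤ ‖z‖ * ‖ζ‖ * ‖twoPoint A z ζ + 1‖ := by
  have hz1 : ‖z‖ < 1 := by simpa using hz.1
  have hζ1 : ‖ζ‖ < 1 := by simpa using hζ
  have key : ∀ᶠ r : ℝ in 𝓝[<] 1,
      ‖twoPoint A z ζ - 1‖ ≤ ‖z‖ / r * (‖ζ‖ / r) * ‖twoPoint A z ζ + 1‖ := by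
    filter_upwards [Ioo_mem_nhdsLT (max_lt hz1 hζ1)] with r hr
    have hzr : ‖z‖ < r := (le_max_left _ _).trans_lt hr.1
    have hζr : ‖ζ‖ < r := (le_max_right _ _).trans_lt hr.1
    have hr0 : 0 < r := (norm_nonneg z).trans_lt hzr
    refine norm_sub_one_le_of_sphere hr0 hr.2 hz.1 hz.2 (hA.differentiableOn_twoPoint_right hz.1)
      (hA.tendsto_twoPoint_right hz.1) (twoPoint_zero_right hz.2)
      ((div_le_one hr0).2 hzr.le) (fun w hw hwne => ?_) hζr.le hne.symm
    have hw' := mem_sphere_zero_iff_norm.1 hw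
    rw [← hw']
    refine hA.norm_twoPoint_sub_one_le_of_norm_le ⟨?_, ?_⟩ (hw' ▸ hzr.le) hwne.symm
    · rw [mem_ball_zero_iff, hw']; exact hr.2
    · exact norm_pos_iff.1 (hw' ▸ hr0)
  have hlim : Tendsto (fun r : ℝ => ‖z‖ / r * (‖ζ‖ / r) * ‖twoPoint A z ζ + 1‖) (𝓝[<] 1)
      (𝓝 (‖z‖ * ‖ζ‖ * ‖twoPoint A z ζ + 1‖)) := by
    have : ContinuousAt (fun r : ℝ => ‖z‖ / r * (‖ζ‖ / r) * ‖twoPoint A z ζ + 1‖) 1 := by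
      fun_prop (disch := norm_num)
    simpa using this.tendsto.mono_left nhdsWithin_le_nhds
  exact ge_of_tendsto hlim key

/-- Divide the two-point inequality by `‖ζ‖` and let `ζ → 0`; the function `f` in the proof is `(P -
1) / ζ`, and `P + 1 → 2`. -/
theorem norm_add_mul_deriv_sub_le (hA : IsConcaveAtZero A) {z : ℂ}
    (hz : z ∈ ball (0 : ℂ) 1 \ {0}) :
    ‖A 0 + z * deriv A z - A z‖ ≤ ‖A 0‖ * ‖z‖ ^ 2 := by
  have hz0 : z ≠ 0 := hz.2
  have h0 : (0 : ℂ) ∈ ball (0 : ℂ) 1 := mem_ball_self one_pos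
  have hA0 := hA.ne_zero
  set f : ℂ → ℂ := fun ζ => -2 * (z * deriv A z - A z) / (ζ * A z - z * A ζ) + 2 / (z - ζ) with hf
  have hden : (0 : ℂ) * A z - z * A 0 ≠ 0 := hA.mul_sub_mul_ne_zero hz.1 h0 hz0
  have hden' : z - 0 ≠ 0 := by simpa using hz0
  have hcA := hA.continuousAt h0
  have hcf : ContinuousAt f 0 := by
    rw [hf]
    fun_prop (disch := assumption)
  have hcP : ContinuousAt (fun ζ => twoPoint A z ζ) 0 := by
    simp only [twoPoint]
    fun_prop (disch := assumption)
  have hev : ∀ᶠ ζ in 𝓝[≠] (0 : ℂ), ‖f ζ‖ ≤ ‖z‖ * ‖twoPoint A z ζ + 1‖ := by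
    have e1 : ∀ᶠ ζ in 𝓝[≠] (0 : ℂ), ζ ∈ ball (0 : ℂ) 1 :=
      eventually_nhdsWithin_of_eventually_nhds (isOpen_ball.mem_nhds h0)
    have e2 : ∀ᶠ ζ in 𝓝[≠] (0 : ℂ), ζ ≠ z :=
      eventually_nhdsWithin_of_eventually_nhds (isOpen_ne.mem_nhds hz0.symm)
    filter_upwards [e1, e2, self_mem_nhdsWithin] with ζ h1 h2 h3
    have h := hA.norm_twoPoint_sub_one_le hz h1 h2.symm
    have hzζ : z - ζ ≠ 0 := sub_ne_zero.2 h2.symm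
    have e : twoPoint A z ζ - 1 = ζ * f ζ := by
      have e3 : (z + ζ) / (z - ζ) = 1 + ζ * (2 / (z - ζ)) := by
        field_simp
        ring
      rw [twoPoint, hf, e3]
      ring
    have hζpos : 0 < ‖ζ‖ := norm_pos_iff.2 h3
    rw [e, norm_mul] at h
    have h' : ‖ζ‖ * ‖f ζ‖ ≤ ‖ζ‖ * (‖z‖ * ‖twoPoint A z ζ + 1‖) := by linarith
    exact le_of_mul_le_mul_left h' hζpos
  have hle : ‖f 0‖ ≤ ‖z‖ * ‖twoPoint A z 0 + 1‖ :=
    le_of_tendsto_of_tendsto (hcf.norm.tendsto.mono_left nhdsWithin_le_nhds)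
      (((hcP.add continuousAt_const).norm.const_mul ‖z‖).tendsto.mono_left nhdsWithin_le_nhds) hev
  have e0 : f 0 = 2 * (A 0 + z * deriv A z - A z) / (z * A 0) := by
    simp only [hf, zero_mul, zero_sub, sub_zero]
    field_simp
    ring
  have hzp : 0 < ‖z‖ := norm_pos_iff.2 hz0
  have hAp : 0 < ‖A 0‖ := norm_pos_iff.2 hA0
  rw [e0, twoPoint_zero_right hz0, norm_div, norm_mul, norm_mul,
    div_le_iff₀ (by positivity)] at hle
  norm_num at hle
  nlinarith

/-- In `A 0 + z * deriv A z - A z` the constant and linear terms cancel and `c * z ^ 2` leads;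
divide by `‖z‖ ^ 2` and let `z → 0`. -/
theorem norm_coeff_le (hA : IsConcaveAtZero A) {b c : ℂ} {R : ℂ → ℂ}
    (hR : DifferentiableOn ℂ R (ball 0 1))
    (h : ∀ z, A z = A 0 + b * z + c * z ^ 2 + z ^ 3 * R z) : ‖c‖ ≤ ‖A 0‖ := by
  have h0 : (0 : ℂ) ∈ ball (0 : ℂ) 1 := mem_ball_self one_pos
  have hev : ∀ᶠ z in 𝓝[≠] (0 : ℂ), ‖c + 2 * z * R z + z ^ 2 * deriv R z‖ ≤ ‖A 0‖ := by
    have e1 : ∀ᶠ z in 𝓝[≠] (0 : ℂ), z ∈ ball (0 : ℂ) 1 :=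
      eventually_nhdsWithin_of_eventually_nhds (isOpen_ball.mem_nhds h0)
    filter_upwards [e1, self_mem_nhdsWithin] with z hz hz0
    have hle := hA.norm_add_mul_deriv_sub_le ⟨hz, hz0⟩
    have hRd := (hR.differentiableAt (isOpen_ball.mem_nhds hz)).hasDerivAt
    have hd : HasDerivAt A (0 + b * 1 + c * (↑2 * z ^ (2 - 1)) +
        (↑3 * z ^ (3 - 1) * R z + z ^ 3 * deriv R z)) z := by
      rw [show A = fun z => A 0 + b * z + c * z ^ 2 + z ^ 3 * R z from funext h]
      exact ((((hasDerivAt_const z (A 0)).add ((hasDerivAt_id z).const_mul b)).add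
        ((hasDerivAt_pow 2 z).const_mul c))).add ((hasDerivAt_pow 3 z).mul hRd)
    have e : A 0 + z * deriv A z - A z = z ^ 2 * (c + 2 * z * R z + z ^ 2 * deriv R z) := by
      rw [hd.deriv, h z]
      push_cast
      ring
    rw [e, norm_mul, norm_pow, mul_comm ‖A 0‖] at hle
    exact le_of_mul_le_mul_left hle (pow_pos (norm_pos_iff.2 hz0) 2)
  have hcR : ContinuousAt R 0 := hR.continuousOn.continuousAt (isOpen_ball.mem_nhds h0)
  have hcR' : ContinuousAt (deriv R) 0 :=
    (hR.deriv isOpen_ball).continuousOn.continuousAt (isOpen_ball.mem_nhds h0)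
  have hc : ContinuousAt (fun z => ‖c + 2 * z * R z + z ^ 2 * deriv R z‖) 0 := by fun_prop
  simpa using le_of_tendsto (hc.tendsto.mono_left nhdsWithin_le_nhds) hev

end IsConcaveAtZero

end TwoPoint

/-! ### Real Möbius automorphisms of the disc -/

section DiscAutomorphism

/-- The automorphism of the unit disc that maps the real number `a` to the origin. -/
def discShift (a : ℝ) (z : ℂ) : ℂ := (z - a) / (1 - a * z)

theorem one_sub_mul_ne_zero {a : ℝ} (ha : |a| < 1) {z : ℂ} (hz : z ∈ ball (0 : ℂ) 1) :
    1 - a * z ≠ 0 := by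
  intro h
  have h1 : ‖(a : ℂ) * z‖ = 1 := by rw [← sub_eq_zero.1 h, norm_one]
  rw [norm_mul, Complex.norm_real, Real.norm_eq_abs] at h1
  have h2 : ‖z‖ < 1 := by simpa using hz
  nlinarith [norm_nonneg z, abs_nonneg a]

theorem discShift_mem_ball {a : ℝ} (ha : |a| < 1) {z : ℂ} (hz : z ∈ ball (0 : ℂ) 1) :
    discShift a z ∈ ball (0 : ℂ) 1 := by
  have h0 := one_sub_mul_ne_zero ha hz
  rw [mem_ball_zero_iff] at hz ⊢
  rw [discShift, norm_div, div_lt_one (norm_pos_iff.2 h0), ← sq_lt_sq₀ (norm_nonneg _)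
    (norm_nonneg _), Complex.sq_norm, Complex.sq_norm, Complex.normSq_apply, Complex.normSq_apply]
  have h1 : z.re * z.re + z.im * z.im < 1 := by
    rw [← Complex.normSq_apply, ← Complex.sq_norm]
    nlinarith [norm_nonneg z]
  have h2 : a ^ 2 < 1 := (sq_lt_one_iff_abs_lt_one a).2 ha
  simp
  nlinarith

theorem discShift_neg_discShift {a : ℝ} (ha : |a| < 1) {z : ℂ} (hz : z ∈ ball (0 : ℂ) 1) :
    discShift (-a) (discShift a z) = z := by
  have h0 := one_sub_mul_ne_zero ha hz
  have h2 : (1 : ℂ) - a ^ 2 ≠ 0 := by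
    have : a ^ 2 < 1 := (sq_lt_one_iff_abs_lt_one a).2 ha
    have h : (1 - a ^ 2 : ℝ) ≠ 0 := by linarith
    exact_mod_cast h
  have h3 : 1 - ((-a : ℝ) : ℂ) * ((z - a) / (1 - a * z)) = (1 - a ^ 2) / (1 - a * z) := by
    push_cast
    field_simp
    ring
  have h4 : 1 - ((-a : ℝ) : ℂ) * discShift a z ≠ 0 := by
    rw [discShift, h3]
    exact div_ne_zero h2 h0
  have h5 : discShift a z * (1 - a * z) = z - a := div_mul_cancel₀ _ h0
  rw [discShift, div_eq_iff h4]
  push_cast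
  linear_combination h5

theorem discShift_discShift_neg {a : ℝ} (ha : |a| < 1) {z : ℂ} (hz : z ∈ ball (0 : ℂ) 1) :
    discShift a (discShift (-a) z) = z := by
  have := discShift_neg_discShift (a := -a) (by rwa [abs_neg]) hz
  rwa [neg_neg] at this

theorem discShift_neg_mem_ball {a : ℝ} (ha : |a| < 1) {z : ℂ} (hz : z ∈ ball (0 : ℂ) 1) :
    discShift (-a) z ∈ ball (0 : ℂ) 1 :=
  discShift_mem_ball (by rwa [abs_neg]) hz

theorem differentiableOn_discShift {a : ℝ} (ha : |a| < 1) :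
    DifferentiableOn ℂ (discShift a) (ball 0 1) := by
  have h : ∀ z ∈ ball (0 : ℂ) 1, 1 - a * z ≠ 0 := fun z hz => one_sub_mul_ne_zero ha hz
  unfold discShift
  fun_prop (disch := assumption)

theorem bijOn_discShift {a : ℝ} (ha : |a| < 1) :
    BijOn (discShift a) (ball 0 1) (ball 0 1) :=
  InvOn.bijOn (f' := discShift (-a))
    ⟨fun _ hz => discShift_neg_discShift ha hz, fun _ hz => discShift_discShift_neg ha hz⟩
    (fun _ hz => discShift_mem_ball ha hz) fun _ hz => discShift_neg_mem_ball ha hz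

theorem discShift_self (a : ℝ) : discShift a a = 0 := by simp [discShift]

theorem discShift_zero (a : ℝ) : discShift a 0 = -a := by simp [discShift]

theorem discShift_ne_zero {a : ℝ} (ha : |a| < 1) {z : ℂ} (hz : z ∈ ball (0 : ℂ) 1)
    (hza : z ≠ a) : discShift a z ≠ 0 :=
  div_ne_zero (sub_ne_zero.2 hza) (one_sub_mul_ne_zero ha hz)

theorem discShift_neg_ne {a : ℝ} (ha : |a| < 1) {z : ℂ} (hz : z ∈ ball (0 : ℂ) 1)
    (hz0 : z ≠ 0) : discShift (-a) z ≠ a := by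
  intro h
  have := discShift_discShift_neg ha hz
  rw [h, discShift_self] at this
  exact hz0 this.symm

theorem hasDerivAt_discShift {a : ℝ} (ha : |a| < 1) {z : ℂ} (hz : z ∈ ball (0 : ℂ) 1) :
    HasDerivAt (discShift a) ((1 - a ^ 2) / (1 - a * z) ^ 2) z := by
  have h0 := one_sub_mul_ne_zero ha hz
  refine (((hasDerivAt_id' z).sub_const (a : ℂ)).div
    (((hasDerivAt_id' z).const_mul (a : ℂ)).const_sub 1) h0).congr_deriv ?_
  congr 1
  ring

end DiscAutomorphism

/-! ### Recovering `ω` from the function -/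

section Representation

/-- The solution `ω v` of `reprFormula p ω v = F v`. -/
def solveOmega (p : ℝ) (F : ℂ → ℂ) (v : ℂ) : ℂ :=
  (1 / v - F v * ((1 - v / p) * (1 - v * p)) / v ^ 2) * ((1 + (p : ℂ) ^ 2) / p) - 1

theorem abs_lt_one_of_mem {p : ℝ} (hp : p ∈ Ioo (0 : ℝ) 1) : |p| < 1 := by
  rw [abs_of_pos hp.1]
  exact hp.2

theorem mem_ball_of_mem {p : ℝ} (hp : p ∈ Ioo (0 : ℝ) 1) : (p : ℂ) ∈ ball (0 : ℂ) 1 := by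
  rw [mem_ball_zero_iff, Complex.norm_real, Real.norm_eq_abs]
  exact abs_lt_one_of_mem hp

theorem ofReal_ne_zero_of_mem {p : ℝ} (hp : p ∈ Ioo (0 : ℝ) 1) : (p : ℂ) ≠ 0 :=
  Complex.ofReal_ne_zero.2 hp.1.ne'

theorem one_sub_sq_ne_zero {p : ℝ} (hp : p ∈ Ioo (0 : ℝ) 1) : (1 : ℂ) - (p : ℂ) ^ 2 ≠ 0 := by
  have h : (1 - p ^ 2 : ℝ) ≠ 0 := by nlinarith [hp.1, hp.2]
  exact_mod_cast h

theorem one_add_sq_ne_zero (p : ℝ) : (1 : ℂ) + (p : ℂ) ^ 2 ≠ 0 := by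
  have h : (1 + p ^ 2 : ℝ) ≠ 0 := by positivity
  exact_mod_cast h

theorem one_sub_div_ne_zero {p : ℝ} (hp : p ∈ Ioo (0 : ℝ) 1) {z : ℂ} (hz : z ≠ p) :
    1 - z / (p : ℂ) ≠ 0 := by
  have := ofReal_ne_zero_of_mem hp
  rw [sub_ne_zero]
  intro h
  rw [eq_div_iff this, one_mul] at h
  exact hz h.symm

theorem one_sub_mul_ne_zero' {p : ℝ} (hp : p ∈ Ioo (0 : ℝ) 1) {z : ℂ}
    (hz : z ∈ ball (0 : ℂ) 1) : 1 - z * (p : ℂ) ≠ 0 := by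
  rw [mul_comm]
  exact one_sub_mul_ne_zero (abs_lt_one_of_mem hp) hz

theorem eq_reprFormula {p : ℝ} (hp : p ∈ Ioo (0 : ℝ) 1) {F : ℂ → ℂ} {v : ℂ}
    (hv : v ∈ ball (0 : ℂ) 1) (hv0 : v ≠ 0) (hvp : v ≠ p) :
    F v = reprFormula p (solveOmega p F) v := by
  have h1 := ofReal_ne_zero_of_mem hp
  have h2 := one_add_sq_ne_zero p
  have h3 := one_sub_div_ne_zero hp hvp
  have h4 := one_sub_mul_ne_zero' hp hv
  rw [reprFormula, eq_div_iff (mul_ne_zero h3 h4), solveOmega]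
  field_simp
  ring

theorem withPole_of_ne {p : ℝ} {F : ℂ → ℂ} {z : Disc} (hz : (z : ℂ) ≠ p) :
    withPole p F z = ((F z : ℂ) : Sphere) := by
  rw [withPole, if_neg hz]

theorem withPole_of_eq {p : ℝ} {F : ℂ → ℂ} {z : Disc} (hz : (z : ℂ) = p) :
    withPole p F z = OnePoint.infty := by
  rw [withPole, if_pos hz]

theorem eqOn_of_withPole_eq {p : ℝ} {F G : ℂ → ℂ} (h : withPole p F = withPole p G) :
    EqOn F G (ball 0 1 \ {(p : ℂ)}) := by
  intro z hz
  have := congrFun h ⟨z, hz.1⟩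
  have hzp : z ≠ p := hz.2
  rw [withPole_of_ne hzp, withPole_of_ne hzp] at this
  exact OnePoint.coe_injective this

theorem withPole_congr {p : ℝ} {F G : ℂ → ℂ} (h : EqOn F G (ball 0 1 \ {(p : ℂ)})) :
    withPole p F = withPole p G := by
  funext z
  by_cases hz : (z : ℂ) = p
  · rw [withPole_of_eq hz, withPole_of_eq hz]
  · rw [withPole_of_ne hz, withPole_of_ne hz, h ⟨z.2, hz⟩]

theorem exists_bounded_extension {U : Set ℂ} (hU : IsOpen U) {c : ℂ} (hc : c ∈ U) {h : ℂ → ℂ}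
    (hd : DifferentiableOn ℂ h (U \ {c})) (hb : ∀ z ∈ U \ {c}, ‖h z‖ ≤ 1) :
    ∃ h' : ℂ → ℂ, DifferentiableOn ℂ h' U ∧ (∀ z ≠ c, h' z = h z) ∧ ∀ z ∈ U, ‖h' z‖ ≤ 1 := by
  have hmem : ∀ᶠ z in 𝓝[≠] c, z ∈ U \ {c} := by
    filter_upwards [eventually_nhdsWithin_of_eventually_nhds (hU.mem_nhds hc),
      self_mem_nhdsWithin] with z h1 h2 using ⟨h1, h2⟩
  have ho : Tendsto (fun z => (z - c) * h z) (𝓝[≠] c) (𝓝 0) := by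
    have h0 : Tendsto (fun z : ℂ => ‖z - c‖) (𝓝[≠] c) (𝓝 0) := by
      have : Continuous fun z : ℂ => ‖z - c‖ := by fun_prop
      simpa using (this.tendsto c).mono_left nhdsWithin_le_nhds
    refine squeeze_zero_norm' ?_ h0
    filter_upwards [hmem] with z hz
    rw [norm_mul]
    exact mul_le_of_le_one_right (norm_nonneg _) (hb z hz)
  obtain ⟨h', hd', he⟩ := exists_differentiableOn_extension (hU.mem_nhds hc) hd ho
  refine ⟨h', hd', he, fun z hz => ?_⟩
  by_cases hzc : z = c
  · subst hzc
    have hcont : ContinuousAt h' z := hd'.continuousOn.continuousAt (hU.mem_nhds hz)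
    refine le_of_tendsto (hcont.norm.tendsto.mono_left
      (nhdsWithin_le_nhds (s := {z}ᶜ))) ?_
    filter_upwards [hmem] with w hw
    rw [he w hw.2]
    exact hb w hw
  · rw [he z hzc]
    exact hb z ⟨hz, hzc⟩

/-- `solveOmega` is holomorphic and bounded off the two points `p` and 0, both of which are
removable. -/
theorem withPole_mem_reprClass {p : ℝ} (hp : p ∈ Ioo (0 : ℝ) 1) {F : ℂ → ℂ}
    (hd : DifferentiableOn ℂ F (ball 0 1 \ {(p : ℂ)})) (h0 : F 0 = 0)
    (hb : ∀ v ∈ ball (0 : ℂ) 1, v ≠ 0 → v ≠ p → ‖solveOmega p F v‖ ≤ 1) :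
    withPole p F ∈ reprClass p := by
  have hp0 := ofReal_ne_zero_of_mem hp
  have hpb := mem_ball_of_mem hp
  have hd1 : DifferentiableOn ℂ (solveOmega p F) ((ball 0 1 \ {0}) \ {(p : ℂ)}) := by
    have h1 : DifferentiableOn ℂ F ((ball 0 1 \ {0}) \ {(p : ℂ)}) :=
      hd.mono fun z hz => ⟨hz.1.1, hz.2⟩
    have h2 : ∀ z ∈ (ball (0 : ℂ) 1 \ {0}) \ {(p : ℂ)}, z ≠ 0 := fun z hz => hz.1.2
    have h3 : ∀ z ∈ (ball (0 : ℂ) 1 \ {0}) \ {(p : ℂ)}, z ^ 2 ≠ 0 := fun z hz =>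
      pow_ne_zero 2 hz.1.2
    unfold solveOmega
    fun_prop (disch := assumption)
  obtain ⟨h₁, hd₁, he₁, hb₁⟩ := exists_bounded_extension isOpen_puncturedDisc ⟨hpb, hp0⟩ hd1
    fun z hz => hb z hz.1.1 hz.1.2 hz.2
  obtain ⟨ω, hdω, heω, hbω⟩ := exists_bounded_extension isOpen_ball (mem_ball_self one_pos) hd₁ hb₁
  refine ⟨ω, hdω, hbω, withPole_congr fun z hz => ?_⟩
  -- At the origin `reprFormula` vanishes for every `ω`.
  by_cases hz0 : z = 0
  · subst hz0
    rw [h0, reprFormula]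
    simp
  · have e : ω z = solveOmega p F z := by rw [heω z hz0, he₁ z hz.2]
    rw [eq_reprFormula (F := F) hp hz.1 hz0 hz.2, reprFormula, reprFormula, e]

end Representation

/-! ### From a pole at `p` to a pole at the origin, and the bound for `ω` -/

section Concave

variable {p : ℝ} {F : ℂ → ℂ}

/-- Transport of a concave function with pole at `p` to a function with pole at the origin. -/
theorem exists_isConcaveAtZero (hp : p ∈ Ioo (0 : ℝ) 1)
    (hd : DifferentiableOn ℂ F (ball (0 : ℂ) 1 \ {(p : ℂ)}))
    (hord : meromorphicOrderAt F (p : ℂ) = ((-1 : ℤ) : WithTop ℤ))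
    (hinj : Injective (withPole p F))
    (hconv : Convex ℝ {w : ℂ | (w : Sphere) ∉ range (withPole p F)}) :
    ∃ A : ℂ → ℂ, IsConcaveAtZero A ∧ ∀ s ≠ 0, A s = s * F (discShift (-p) s) := by
  have hpa := abs_lt_one_of_mem hp
  have hpna : |-p| < 1 := by rwa [abs_neg]
  have hpb := mem_ball_of_mem hp
  have hp2 := one_sub_sq_ne_zero hp
  have hb0 : (0 : ℂ) ∈ ball (0 : ℂ) 1 := mem_ball_self one_pos
  -- The order defaults to 0 for functions that are not meromorphic, so order `-1` implies
  -- meromorphy.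
  have hmer : MeromorphicAt F p := by
    by_contra h
    rw [meromorphicOrderAt_of_not_meromorphicAt h] at hord
    exact absurd hord (by decide)
  obtain ⟨g, hg, hg0, hFg⟩ := (meromorphicOrderAt_eq_int_iff hmer).1 hord
  have hTb : ∀ s ∈ ball (0 : ℂ) 1 \ {0}, discShift (-p) s ∈ ball (0 : ℂ) 1 \ {(p : ℂ)} :=
    fun s hs => ⟨discShift_neg_mem_ball hpa hs.1, discShift_neg_ne hpa hs.1 hs.2⟩
  set f₀ : ℂ → ℂ := fun s => s * F (discShift (-p) s) with hf₀
  -- The value at 0 is the limit of `s * F (discShift (-p) s)`, found from `discShift (-p) s - p = s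
  -- (1 - p²) / (1 + p s)` and `F z = g z / (z - p)` near `p`.
  set A : ℂ → ℂ := update f₀ 0 (g p / (1 - (p : ℂ) ^ 2)) with hA
  have hAs : ∀ s ≠ 0, A s = s * F (discShift (-p) s) := fun s hs => update_of_ne hs _ _
  have hAdiv : ∀ s ≠ 0, A s / s = F (discShift (-p) s) := fun s hs => by
    rw [hAs s hs, mul_div_cancel_left₀ _ hs]
  have hT0 : discShift (-p) 0 = p := by simp [discShift_zero]
  have hlim : Tendsto f₀ (𝓝[≠] 0) (𝓝 (g p / (1 - (p : ℂ) ^ 2))) := by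
    have hTc : ContinuousAt (discShift (-p)) 0 :=
      (differentiableOn_discShift hpna).continuousOn.continuousAt (isOpen_ball.mem_nhds hb0)
    have hin : ∀ᶠ s in 𝓝[≠] (0 : ℂ), s ∈ ball (0 : ℂ) 1 \ {0} := by
      filter_upwards [eventually_nhdsWithin_of_eventually_nhds (isOpen_ball.mem_nhds hb0),
        self_mem_nhdsWithin] with z h1 h2 using ⟨h1, h2⟩
    have hTt : Tendsto (discShift (-p)) (𝓝[≠] 0) (𝓝[≠] (p : ℂ)) := by
      rw [tendsto_nhdsWithin_iff]
      refine ⟨?_, hin.mono fun s hs => (hTb s hs).2⟩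
      have := hTc.tendsto
      rw [hT0] at this
      exact this.mono_left nhdsWithin_le_nhds
    have hgT : Tendsto (fun s : ℂ => (1 + p * s) / (1 - (p : ℂ) ^ 2) * g (discShift (-p) s))
        (𝓝[≠] 0) (𝓝 (g p / (1 - (p : ℂ) ^ 2))) := by
      have h1 : ContinuousAt (fun s : ℂ => (1 + p * s) / (1 - (p : ℂ) ^ 2) *
          g (discShift (-p) s)) 0 := by
        have h2 : ContinuousAt (fun s => g (discShift (-p) s)) 0 :=
          ContinuousAt.comp (g := g) (by rw [hT0]; exact hg.continuousAt) hTc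
        exact ContinuousAt.mul (by fun_prop) h2
      have h3 := h1.tendsto.mono_left (nhdsWithin_le_nhds (s := {0}ᶜ))
      rw [hT0] at h3
      convert h3 using 2
      ring
    refine hgT.congr' ?_
    filter_upwards [hTt.eventually hFg, hin] with s hs hsb
    have hs0 : s ≠ 0 := hsb.2
    have hm : 1 + (p : ℂ) * s ≠ 0 := by
      have := one_sub_mul_ne_zero hpna hsb.1
      push_cast at this
      rwa [neg_mul, sub_neg_eq_add] at this
    have hTp : discShift (-p) s - p = s * (1 - (p : ℂ) ^ 2) / (1 + p * s) := by
      have h5 : discShift (-p) s * (1 + p * s) = s + p := by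
        rw [discShift]
        push_cast
        rw [neg_mul, sub_neg_eq_add, sub_neg_eq_add]
        exact div_mul_cancel₀ _ hm
      rw [eq_div_iff hm]
      linear_combination h5
    simp only [hf₀]
    rw [hs, hTp, smul_eq_mul, zpow_neg_one]
    field_simp
  have hAd : DifferentiableOn ℂ A (ball 0 1) := by
    rw [← Complex.differentiableOn_compl_singleton_and_continuousAt_iff
      (isOpen_ball.mem_nhds hb0)]
    refine ⟨?_, continuousAt_update_same.2 hlim⟩
    have h1 : DifferentiableOn ℂ f₀ (ball 0 1 \ {0}) :=
      differentiableOn_id.mul (hd.comp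
        ((differentiableOn_discShift hpna).mono sdiff_subset) hTb)
    exact h1.congr fun s hs => hAs s hs.2
  have hFinj : InjOn F (ball (0 : ℂ) 1 \ {(p : ℂ)}) := by
    intro z hz w hw h
    have hzp : z ≠ p := hz.2
    have hwp : w ≠ p := hw.2
    have := @hinj ⟨z, hz.1⟩ ⟨w, hw.1⟩ (by rw [withPole_of_ne hzp, withPole_of_ne hwp, h])
    exact congrArg Subtype.val this
  have hrange : {w : ℂ | (w : Sphere) ∉ range (withPole p F)} =
      ((fun z => A z / z) '' (ball 0 1 \ {0}))ᶜ := by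
    ext w
    simp only [mem_ofPred_eq, mem_compl_iff, not_iff_not]
    constructor
    · rintro ⟨z, hz⟩
      have hzp : (z : ℂ) ≠ p := by
        intro h
        rw [withPole_of_eq h] at hz
        exact OnePoint.infty_ne_coe w hz
      rw [withPole_of_ne hzp] at hz
      have hs0 := discShift_ne_zero hpa z.2 hzp
      refine ⟨discShift p z, ⟨discShift_mem_ball hpa z.2, hs0⟩, ?_⟩
      simp only
      rw [hAdiv _ hs0, discShift_neg_discShift hpa z.2]
      exact OnePoint.coe_injective hz
    · rintro ⟨s, hs, rfl⟩
      refine ⟨⟨discShift (-p) s, (hTb s hs).1⟩, ?_⟩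
      have hTp : discShift (-p) s ≠ p := (hTb s hs).2
      rw [withPole_of_ne hTp]
      simp only
      rw [hAdiv s hs.2]
  refine ⟨A, ⟨hAd, ?_, ?_, hrange ▸ hconv⟩, hAs⟩
  · rw [hA, update_self]
    exact div_ne_zero hg0 hp2
  · intro s hs t ht h
    simp only at h
    rw [hAdiv s hs.2, hAdiv t ht.2] at h
    exact (bijOn_discShift hpna).injOn hs.1 ht.1 (hFinj (hTb s hs) (hTb t ht) h)

/-- The point `-p` goes to the normalisation point 0, where the automorphism has derivative `1 / (1
- p²)`; the factor `s` contributes `-p`. -/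
theorem transport_zero_and_deriv (hp : p ∈ Ioo (0 : ℝ) 1)
    (hd : DifferentiableOn ℂ F (ball (0 : ℂ) 1 \ {(p : ℂ)})) (h0 : F 0 = 0) (h1 : deriv F 0 = 1)
    {A : ℂ → ℂ} (hAs : ∀ s ≠ 0, A s = s * F (discShift (-p) s)) :
    A (-p) = 0 ∧ deriv A (-p) = -(p / (1 - (p : ℂ) ^ 2)) := by
  have hp0 := ofReal_ne_zero_of_mem hp
  have hpa := abs_lt_one_of_mem hp
  have hpna : |-p| < 1 := by rwa [abs_neg]
  have hpb : -(p : ℂ) ∈ ball (0 : ℂ) 1 := by simpa using mem_ball_of_mem hp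
  have hp2 := one_sub_sq_ne_zero hp
  have hTp : discShift (-p) (-(p : ℂ)) = 0 := by
    have := discShift_self (-p)
    push_cast at this
    exact this
  refine ⟨by rw [hAs _ (neg_ne_zero.2 hp0), hTp, h0, mul_zero], ?_⟩
  have hF : HasDerivAt F 1 (discShift (-p) (-(p : ℂ))) := by
    rw [hTp, ← h1]
    refine (hd.differentiableAt ((isOpen_ball.sdiff isClosed_singleton).mem_nhds
      ⟨mem_ball_self one_pos, hp0.symm⟩)).hasDerivAt
  have hT := hasDerivAt_discShift hpna hpb
  have hm := (hasDerivAt_id' (-(p : ℂ))).mul (hF.comp (-(p : ℂ)) hT)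
  have hev : A =ᶠ[𝓝 (-(p : ℂ))] fun s => s * (F ∘ discShift (-p)) s := by
    filter_upwards [isOpen_ne.mem_nhds (neg_ne_zero.2 hp0)] with s hs using hAs s hs
  rw [(hm.congr_of_eventuallyEq hev).deriv, Function.comp_apply, hTp, h0]
  push_cast
  rw [neg_mul_neg]
  simp only [neg_sq, ← sq]
  field_simp
  ring

/-- `|X + qY|² - |qX + Y|² = (1 - q²)(|X|² - |Y|²)`. -/
theorem norm_sq_mul_add_le {q : ℝ} (hq0 : 0 ≤ q) (hq : q ≤ 1) {X Y : ℂ} (h : ‖Y‖ ≤ ‖X‖) :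
    ‖q * X + Y‖ ≤ ‖X + q * Y‖ := by
  rw [← sq_le_sq₀ (norm_nonneg _) (norm_nonneg _), Complex.sq_norm, Complex.sq_norm] at h ⊢
  rw [Complex.normSq_apply, Complex.normSq_apply] at h ⊢
  simp
  have : 0 ≤ 1 - q ^ 2 := by nlinarith
  nlinarith

/-- The two-point inequality at `(-p, s)` reads `‖Y‖ ≤ ‖X‖` with `X = p s (P + 1)`, `Y = P - 1`. The
normalisation makes `P` explicit in `F v`, and `ω = (p² X + Y) / (X + p² Y)` is then bounded by 1.
-/
theorem norm_solveOmega_le (hp : p ∈ Ioo (0 : ℝ) 1) {A : ℂ → ℂ} (hA : IsConcaveAtZero A)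
    (hAs : ∀ s ≠ 0, A s = s * F (discShift (-p) s)) (hAp : A (-p) = 0)
    (hAp' : deriv A (-p) = -(p / (1 - (p : ℂ) ^ 2))) {v : ℂ} (hv : v ∈ ball (0 : ℂ) 1)
    (hv0 : v ≠ 0) (hvp : v ≠ p) : ‖solveOmega p F v‖ ≤ 1 := by
  have hp0 := ofReal_ne_zero_of_mem hp
  have hpa := abs_lt_one_of_mem hp
  have hpb : -(p : ℂ) ∈ ball (0 : ℂ) 1 \ {0} :=
    ⟨by simpa using mem_ball_of_mem hp, neg_ne_zero.2 hp0⟩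
  have hp2 := one_sub_sq_ne_zero hp
  have hp3 := one_add_sq_ne_zero p
  have hm := one_sub_mul_ne_zero hpa hv
  set s := discShift p v with hs
  have hsb : s ∈ ball (0 : ℂ) 1 := discShift_mem_ball hpa hv
  have hs0 : s ≠ 0 := discShift_ne_zero hpa hv hvp
  have hsp : -(p : ℂ) ≠ s := by
    intro h
    have h1 := discShift_neg_discShift hpa hv
    have h2 := discShift_self (-p)
    push_cast at h2
    rw [← hs, ← h, h2] at h1
    exact hv0 h1.symm
  have hAsv : A s = s * F v := by rw [hAs s hs0, hs, discShift_neg_discShift hpa hv]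
  have hFv : F v ≠ 0 := by
    intro h
    have := hA.mul_sub_mul_ne_zero hpb.1 hsb hsp
    rw [hAp, hAsv, h] at this
    simp at this
  have hP := hA.norm_twoPoint_sub_one_le hpb hsb hsp
  set P := twoPoint A (-p) s with hPdef
  have hvp' : v - p ≠ 0 := sub_ne_zero.2 hvp
  have hPe : P = -(2 * p / ((1 - (p : ℂ) ^ 2) * F v)) + (2 * p - (1 + (p : ℂ) ^ 2) * v) /
      ((1 - (p : ℂ) ^ 2) * v) := by
    rw [hPdef, twoPoint, hAp, hAp', hAsv]
    congr 1
    · field_simp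
      ring
    · have e1 : -(p : ℂ) + s = ((1 + (p : ℂ) ^ 2) * v - 2 * p) / (1 - p * v) := by
        rw [hs, discShift]
        field_simp
        ring
      have e2 : -(p : ℂ) - s = -((1 - (p : ℂ) ^ 2) * v) / (1 - p * v) := by
        rw [hs, discShift]
        field_simp
        ring
      rw [e1, e2]
      field_simp
      ring
  set X := (p : ℂ) * s * (P + 1) with hX
  set Y := P - 1 with hY
  have hYX : ‖Y‖ ≤ ‖X‖ := by
    rw [hX, norm_mul, norm_mul]
    rwa [norm_neg] at hP
  have hq0 : (0 : ℝ) ≤ p ^ 2 := sq_nonneg p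
  have hq1 : p ^ 2 < 1 := (sq_lt_one_iff_abs_lt_one p).2 hpa
  have hle := norm_sq_mul_add_le hq0 hq1.le hYX
  -- If the denominator vanished, `p² < 1` would force `X = Y = 0`, that is `P = -1` and `P = 1`.
  have hne : X + ((p ^ 2 : ℝ) : ℂ) * Y ≠ 0 := by
    intro h
    have h1 : ‖X‖ = p ^ 2 * ‖Y‖ := by
      rw [eq_neg_of_add_eq_zero_left h, norm_neg, norm_mul, Complex.norm_real,
        Real.norm_of_nonneg hq0]
    have hX0 : ‖X‖ = 0 := by nlinarith [norm_nonneg X, norm_nonneg Y]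
    have hY0 : ‖Y‖ = 0 := le_antisymm (hYX.trans_eq hX0) (norm_nonneg _)
    rw [norm_eq_zero] at hX0 hY0
    have h2 : P + 1 = 0 := by
      rcases mul_eq_zero.1 hX0 with h3 | h3
      · exact absurd h3 (mul_ne_zero hp0 hs0)
      · exact h3
    have h3 : (2 : ℂ) = 0 := by linear_combination h2 - hY0
    exact two_ne_zero h3
  have key : solveOmega p F v = (((p ^ 2 : ℝ) : ℂ) * X + Y) / (X + ((p ^ 2 : ℝ) : ℂ) * Y) := by
    have e1 : P + 1 = 2 * p * ((1 - p * v) * F v - v) / ((1 - (p : ℂ) ^ 2) * v * F v) := by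
      rw [hPe]
      field_simp
      ring
    have e2 : Y = -2 * (p * v + (v - p) * F v) / ((1 - (p : ℂ) ^ 2) * v * F v) := by
      rw [hY, hPe]
      field_simp
      ring
    rw [eq_div_iff hne, hX, e1, e2, solveOmega, hs, discShift, mul_comm v (p : ℂ)]
    clear_value X Y P s
    obtain ⟨m, hmv⟩ : ∃ m : ℂ, m = 1 - p * v := ⟨_, rfl⟩
    rw [← hmv] at hm ⊢
    push_cast
    field_simp
    rw [hmv]
    ring
  rw [key, norm_div, div_le_one (norm_pos_iff.2 hne)]
  exact hle

/-- At `z = -p` the one-point inequality reads `‖A 0 + q‖ ≤ ‖A 0‖ p²` with `q = p² / (1 - p²)`, so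
`‖A 0‖ (1 - p²) ≤ q`. -/
theorem norm_apply_zero_le (hp : p ∈ Ioo (0 : ℝ) 1) {A : ℂ → ℂ} (hA : IsConcaveAtZero A)
    (hAp : A (-p) = 0) (hAp' : deriv A (-p) = -(p / (1 - (p : ℂ) ^ 2))) :
    ‖A 0‖ ≤ p ^ 2 / (1 - p ^ 2) ^ 2 := by
  have hp0 := ofReal_ne_zero_of_mem hp
  have hpb : -(p : ℂ) ∈ ball (0 : ℂ) 1 \ {0} :=
    ⟨by simpa using mem_ball_of_mem hp, neg_ne_zero.2 hp0⟩
  have h := hA.norm_add_mul_deriv_sub_le hpb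
  have hq1 : 0 < 1 - p ^ 2 := by nlinarith [hp.1, hp.2]
  set q : ℝ := p ^ 2 / (1 - p ^ 2) with hq
  have hq0 : 0 ≤ q := by positivity
  have e : A 0 + -(p : ℂ) * deriv A (-p) - A (-p) = A 0 + (q : ℂ) := by
    rw [hAp, hAp', hq]
    push_cast
    ring
  rw [e, norm_neg, Complex.norm_real, Real.norm_eq_abs, sq_abs] at h
  have h2 : ‖A 0‖ ≤ ‖A 0 + (q : ℂ)‖ + q := by
    calc ‖A 0‖ = ‖(A 0 + (q : ℂ)) - q‖ := by rw [add_sub_cancel_right]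
      _ ≤ ‖A 0 + (q : ℂ)‖ + ‖(q : ℂ)‖ := norm_sub_le _ _
      _ = _ := by rw [Complex.norm_real, Real.norm_of_nonneg hq0]
  have h3 : p ^ 2 / (1 - p ^ 2) ^ 2 = q / (1 - p ^ 2) := by
    rw [hq]
    field_simp
  rw [h3, le_div_iff₀ hq1]
  linarith

end Concave

/-! ### The Laurent coefficient as a contour integral -/

section Laurent

/-- A function with a simple pole at `p`, expanded to order two, with holomorphic remainder. -/
def HasPrincipalExpansion (p : ℝ) (F : ℂ → ℂ) (γ : ℂ) : Prop :=
  ∃ α β : ℂ, ∃ H : ℂ → ℂ, DifferentiableOn ℂ H (ball 0 1) ∧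
    ∀ z ∈ ball (0 : ℂ) 1 \ {(p : ℂ)},
      F z = α * (z - p)⁻¹ + β + γ * (z - p) + (z - p) ^ 2 * H z

/-- The coefficient of `z - p` in the Laurent expansion at `p`. -/
def laurentCoeff (p : ℝ) (F : ℂ → ℂ) : ℂ :=
  (2 * Real.pi * Complex.I)⁻¹ * ∮ z in C((p : ℂ), (1 - p) / 2), F z * ((z - p) ^ 2)⁻¹

variable {p : ℝ} {F G : ℂ → ℂ}

/-- Here `t = z - q`, `m = 1 - q z` and `t / m` is the transported variable. The coefficient of `t`
involves only `c`, because `b` contributes only to the constant term and `a * m / t` is affine in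
`t⁻¹`. -/
theorem transport_expansion {q t m a b c ρ : ℂ} (ht : t ≠ 0) (hm : m ≠ 0) (hq : 1 - q ^ 2 ≠ 0)
    (hmt : m = 1 - q ^ 2 - q * t) :
    (a + b * (t / m) + c * (t / m) ^ 2 + (t / m) ^ 3 * ρ) / (t / m) =
      a * (1 - q ^ 2) * t⁻¹ + (b - a * q) + c / (1 - q ^ 2) * t +
        t ^ 2 * (c * q / ((1 - q ^ 2) * m) + ρ / m ^ 2) := by
  field_simp
  rw [hmt]
  ring

theorem hasPrincipalExpansion_of_transport (hp : p ∈ Ioo (0 : ℝ) 1) {a b c : ℂ} {R : ℂ → ℂ}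
    (hR : DifferentiableOn ℂ R (ball 0 1))
    (h : ∀ z ∈ ball (0 : ℂ) 1 \ {(p : ℂ)}, F z * discShift p z = a + b * discShift p z +
      c * discShift p z ^ 2 + discShift p z ^ 3 * R (discShift p z)) :
    HasPrincipalExpansion p F (c / (1 - (p : ℂ) ^ 2)) := by
  have hpa := abs_lt_one_of_mem hp
  have hp2 := one_sub_sq_ne_zero hp
  refine ⟨a * (1 - (p : ℂ) ^ 2), b - a * p, fun z => c * p / ((1 - (p : ℂ) ^ 2) * (1 - p * z)) +
    R (discShift p z) / (1 - p * z) ^ 2, ?_, fun z hz => ?_⟩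
  · have h1 : ∀ z ∈ ball (0 : ℂ) 1, (1 - (p : ℂ) ^ 2) * (1 - p * z) ≠ 0 := fun z hz =>
      mul_ne_zero hp2 (one_sub_mul_ne_zero hpa hz)
    have h2 : ∀ z ∈ ball (0 : ℂ) 1, (1 - (p : ℂ) * z) ^ 2 ≠ 0 := fun z hz =>
      pow_ne_zero 2 (one_sub_mul_ne_zero hpa hz)
    have h3 : DifferentiableOn ℂ (fun z => R (discShift p z)) (ball 0 1) :=
      hR.comp (differentiableOn_discShift hpa) fun z hz => discShift_mem_ball hpa hz
    exact (DifferentiableOn.div (by fun_prop) (by fun_prop) h1).add (h3.div (by fun_prop) h2)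
  · have hs0 := discShift_ne_zero hpa hz.1 hz.2
    have hm := one_sub_mul_ne_zero hpa hz.1
    have ht : z - p ≠ 0 := sub_ne_zero.2 hz.2
    have h1 := h z hz
    beta_reduce
    generalize R (discShift p z) = ρ at h1 ⊢
    have e : F z = (a + b * discShift p z + c * discShift p z ^ 2 + discShift p z ^ 3 * ρ) /
        discShift p z := (eq_div_iff hs0).2 h1
    rw [e, discShift]
    exact transport_expansion ht hm hp2 (by ring)

theorem sphere_subset_ball_diff (hp : p ∈ Ioo (0 : ℝ) 1) :
    sphere (p : ℂ) ((1 - p) / 2) ⊆ ball (0 : ℂ) 1 \ {(p : ℂ)} := by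
  intro z hz
  have h1 := mem_sphere_iff_norm.1 hz
  refine ⟨?_, ?_⟩
  · rw [mem_ball_zero_iff]
    have h2 : ‖z‖ ≤ ‖z - p‖ + ‖(p : ℂ)‖ := by
      simpa using norm_add_le (z - p) (p : ℂ)
    rw [h1, Complex.norm_real, Real.norm_of_nonneg hp.1.le] at h2
    linarith [hp.2]
  · intro h
    rw [mem_singleton_iff.1 h, sub_self, norm_zero] at h1
    linarith [hp.2]

theorem closedBall_subset_unitBall (hp : p ∈ Ioo (0 : ℝ) 1) :
    closedBall (p : ℂ) ((1 - p) / 2) ⊆ ball (0 : ℂ) 1 := by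
  refine closedBall_subset_ball' ?_
  rw [dist_zero_right, Complex.norm_real, Real.norm_of_nonneg hp.1.le]
  linarith [hp.2]

/-- After division by `(z - p)²` only the term `γ / (z - p)` has a nonzero integral. -/
theorem laurentCoeff_eq (hp : p ∈ Ioo (0 : ℝ) 1) {γ : ℂ} (h : HasPrincipalExpansion p F γ) :
    laurentCoeff p F = γ := by
  obtain ⟨α, β, H, hH, hF⟩ := h
  set ρ := (1 - p) / 2 with hρ
  have hρ0 : 0 < ρ := by rw [hρ]; linarith [hp.2]
  have hne : ∀ z ∈ sphere (p : ℂ) ρ, z - p ≠ 0 := fun z hz =>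
    sub_ne_zero.2 (sphere_subset_ball_diff hp hz).2
  have hint : ∀ n : ℤ, CircleIntegrable (fun z => (z - (p : ℂ)) ^ n) p ρ := fun n => by
    rw [circleIntegrable_sub_zpow_iff]
    right; right
    rw [abs_of_pos hρ0]
    simpa using hρ0.ne
  have hHc : DiffContOnCl ℂ H (ball (p : ℂ) ρ) :=
    DifferentiableOn.diffContOnCl (hH.mono (by
      rw [closure_ball _ hρ0.ne']
      exact closedBall_subset_unitBall hp))
  have hHi : CircleIntegrable H p ρ :=
    ContinuousOn.circleIntegrable hρ0.le (hH.continuousOn.mono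
      (sphere_subset_closedBall.trans (closedBall_subset_unitBall hp)))
  have hcongr : (∮ z in C((p : ℂ), ρ), F z * ((z - p) ^ 2)⁻¹) =
      ∮ z in C((p : ℂ), ρ), (α * (z - p) ^ (-3 : ℤ) + β * (z - p) ^ (-2 : ℤ) +
        γ * (z - p) ^ (-1 : ℤ) + H z) := by
    refine circleIntegral.integral_congr hρ0.le fun z hz => ?_
    rw [hF z (sphere_subset_ball_diff hp hz)]
    have hz0 := hne z hz
    rw [zpow_neg_one, show (-3 : ℤ) = -((3 : ℕ) : ℤ) from rfl,
      show (-2 : ℤ) = -((2 : ℕ) : ℤ) from rfl, zpow_neg, zpow_neg, zpow_natCast, zpow_natCast]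
    field_simp
  have i1 : CircleIntegrable (fun z => α * (z - (p : ℂ)) ^ (-3 : ℤ)) p ρ := (hint _).const_fun_smul
  have i2 : CircleIntegrable (fun z => β * (z - (p : ℂ)) ^ (-2 : ℤ)) p ρ := (hint _).const_fun_smul
  have i3 : CircleIntegrable (fun z => γ * (z - (p : ℂ)) ^ (-1 : ℤ)) p ρ := (hint _).const_fun_smul
  have i12 : CircleIntegrable (fun z => α * (z - (p : ℂ)) ^ (-3 : ℤ) +
    β * (z - (p : ℂ)) ^ (-2 : ℤ)) p ρ := i1.add i2
  have i123 : CircleIntegrable (fun z => α * (z - (p : ℂ)) ^ (-3 : ℤ) +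
    β * (z - (p : ℂ)) ^ (-2 : ℤ) + γ * (z - (p : ℂ)) ^ (-1 : ℤ)) p ρ := i12.add i3
  rw [laurentCoeff, hcongr, circleIntegral.integral_add i123 hHi,
    circleIntegral.integral_add i12 i3, circleIntegral.integral_add i1 i2,
    circleIntegral.integral_const_mul, circleIntegral.integral_const_mul,
    circleIntegral.integral_const_mul, circleIntegral.integral_sub_zpow_of_ne (by decide),
    circleIntegral.integral_sub_zpow_of_ne (by decide), hHc.circleIntegral_eq_zero hρ0.le]
  simp only [zpow_neg_one]
  rw [circleIntegral.integral_sub_center_inv _ hρ0.ne']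
  have := Complex.two_pi_I_ne_zero
  field_simp
  ring

theorem hasLaurentExpansion_of_principal (hp : p ∈ Ioo (0 : ℝ) 1) {γ : ℂ}
    (h : HasPrincipalExpansion p F γ) :
    ∃ a : ℤ → ℂ, HasLaurentExpansion p (withPole p F) a ∧ a 1 = γ := by
  obtain ⟨α, β, H, hH, hF⟩ := h
  have hsub : ball (p : ℂ) (1 - p) ⊆ ball 0 1 := by
    refine ball_subset_ball' ?_
    rw [dist_zero_right, Complex.norm_real, Real.norm_of_nonneg hp.1.le]
    linarith
  set c : ℕ → ℂ := fun n => (n.factorial : ℂ)⁻¹ * iteratedDeriv n H p with hc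
  refine ⟨fun k => if k = -1 then α else if k = 0 then β else if k = 1 then γ else
    c (k - 2).toNat, fun z hzp hz => ⟨F z, withPole_of_ne hzp, ?_⟩, by simp⟩
  have ht : (z : ℂ) - p ≠ 0 := sub_ne_zero.2 hzp
  have hs := (Complex.hasSum_taylorSeries_on_ball (hH.mono hsub)
    (mem_ball_iff_norm.2 hz)).mul_left (((z : ℂ) - p) ^ 2)
  set f : ℕ → ℂ := fun k => (if (k : ℤ) - 1 = -1 then α else if (k : ℤ) - 1 = 0 then β else
    if (k : ℤ) - 1 = 1 then γ else c ((k : ℤ) - 1 - 2).toNat) * ((z : ℂ) - p) ^ ((k : ℤ) - 1)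
    with hf
  -- The indices 0, 1, 2 carry `α`, `β`, `γ`; from index 3 on, the series is `(z - p)²` times the
  -- Taylor series of `H`.
  have h1 : (fun n => f (n + 3)) = fun n : ℕ => ((z : ℂ) - p) ^ 2 *
      ((n.factorial : ℂ)⁻¹ • ((z : ℂ) - p) ^ n • iteratedDeriv n H p) := by
    funext n
    have e1 : ((n + 3 : ℕ) : ℤ) - 1 = ((n + 2 : ℕ) : ℤ) := by push_cast; ring
    have e2 : (((n + 2 : ℕ) : ℤ) - 2).toNat = n := by omega
    simp only [hf]
    rw [e1, zpow_natCast, if_neg (by omega), if_neg (by omega), if_neg (by omega), e2, hc]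
    simp only [smul_eq_mul]
    ring
  rw [← h1] at hs
  have h3 := (hasSum_nat_add_iff 3).1 hs
  have h4 : ((z : ℂ) - p) ^ 2 * H z + ∑ i ∈ Finset.range 3, f i = F z := by
    rw [hF z ⟨z.2, hzp⟩]
    simp [Finset.sum_range_succ, hf]
    ring
  rw [h4] at h3
  exact h3

theorem HasPrincipalExpansion.differentiableOn {γ : ℂ} (h : HasPrincipalExpansion p F γ) :
    DifferentiableOn ℂ F (ball 0 1 \ {(p : ℂ)}) := by
  obtain ⟨α, β, H, hH, hF⟩ := h
  refine DifferentiableOn.congr ?_ hF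
  have h1 : ∀ z ∈ ball (0 : ℂ) 1 \ {(p : ℂ)}, z - p ≠ 0 := fun z hz => sub_ne_zero.2 hz.2
  have h2 : DifferentiableOn ℂ H (ball 0 1 \ {(p : ℂ)}) := hH.mono sdiff_subset
  fun_prop (disch := assumption)

theorem circleIntegrable_div_sq (hp : p ∈ Ioo (0 : ℝ) 1)
    (hF : ContinuousOn F (ball 0 1 \ {(p : ℂ)})) :
    CircleIntegrable (fun z => F z * ((z - p) ^ 2)⁻¹) p ((1 - p) / 2) := by
  refine ContinuousOn.circleIntegrable (by linarith [hp.2]) ?_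
  have h1 : ∀ z ∈ sphere (p : ℂ) ((1 - p) / 2), (z - (p : ℂ)) ^ 2 ≠ 0 := fun z hz =>
    pow_ne_zero 2 (sub_ne_zero.2 (sphere_subset_ball_diff hp hz).2)
  have h2 := hF.mono (sphere_subset_ball_diff hp)
  fun_prop (disch := assumption)

theorem laurentCoeff_congr (hp : p ∈ Ioo (0 : ℝ) 1) (h : EqOn F G (ball 0 1 \ {(p : ℂ)})) :
    laurentCoeff p F = laurentCoeff p G := by
  rw [laurentCoeff, laurentCoeff]
  congr 1
  refine circleIntegral.integral_congr (by linarith [hp.2]) fun z hz => ?_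
  rw [h (sphere_subset_ball_diff hp hz)]

theorem laurentCoeff_combination (hp : p ∈ Ioo (0 : ℝ) 1)
    (hF : ContinuousOn F (ball 0 1 \ {(p : ℂ)})) (hG : ContinuousOn G (ball 0 1 \ {(p : ℂ)}))
    (a b : ℂ) : laurentCoeff p (fun z => a * F z + b * G z) =
      a * laurentCoeff p F + b * laurentCoeff p G := by
  have h1 : CircleIntegrable (fun z => a * (F z * ((z - p) ^ 2)⁻¹)) p ((1 - p) / 2) :=
    (circleIntegrable_div_sq hp hF).const_fun_smul
  have h2 : CircleIntegrable (fun z => b * (G z * ((z - p) ^ 2)⁻¹)) p ((1 - p) / 2) :=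
    (circleIntegrable_div_sq hp hG).const_fun_smul
  simp only [laurentCoeff, add_mul, mul_assoc a, mul_assoc b]
  rw [circleIntegral.integral_add h1 h2, circleIntegral.integral_const_mul,
    circleIntegral.integral_const_mul]
  ring

theorem norm_laurentCoeff_sub_le (hp : p ∈ Ioo (0 : ℝ) 1)
    (hF : ContinuousOn F (ball 0 1 \ {(p : ℂ)})) (hG : ContinuousOn G (ball 0 1 \ {(p : ℂ)}))
    {ε : ℝ} (h : ∀ z ∈ sphere (p : ℂ) ((1 - p) / 2), ‖F z - G z‖ ≤ ε) :
    ‖laurentCoeff p F - laurentCoeff p G‖ ≤ ε / ((1 - p) / 2) := by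
  set ρ := (1 - p) / 2 with hρ
  have hρ0 : 0 < ρ := by rw [hρ]; linarith [hp.2]
  rw [laurentCoeff, laurentCoeff, ← mul_sub, ← circleIntegral.integral_sub
    (circleIntegrable_div_sq hp hF) (circleIntegrable_div_sq hp hG), norm_mul]
  have hi : ‖∮ z in C((p : ℂ), ρ), (F z * ((z - p) ^ 2)⁻¹ - G z * ((z - p) ^ 2)⁻¹)‖ ≤
      2 * Real.pi * ρ * (ε * (ρ ^ 2)⁻¹) := by
    refine circleIntegral.norm_integral_le_of_norm_le_const hρ0.le fun z hz => ?_
    rw [← sub_mul, norm_mul, norm_inv, norm_pow, mem_sphere_iff_norm.1 hz]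
    gcongr
    exact h z hz
  have hc : ‖(2 * Real.pi * Complex.I : ℂ)⁻¹‖ = (2 * Real.pi)⁻¹ := by
    simp [abs_of_pos Real.pi_pos]
  rw [hc]
  calc _ ≤ (2 * Real.pi)⁻¹ * (2 * Real.pi * ρ * (ε * (ρ ^ 2)⁻¹)) := by gcongr
    _ = _ := by
      have := Real.pi_pos
      field_simp

end Laurent

/-! ### A closed convex condition containing `Co p` -/

section ClosedHull

variable {p : ℝ}

/-- A closed convex set of functions that contains the finite parts of all functions of `Co p`. -/
def admissible (p : ℝ) : Set (ℂ → ℂ) :=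
  {F | DifferentiableOn ℂ F (ball 0 1 \ {(p : ℂ)}) ∧ F 0 = 0 ∧
    (∀ v ∈ ball (0 : ℂ) 1, v ≠ 0 → v ≠ p → ‖solveOmega p F v‖ ≤ 1) ∧
    -(p ^ 2 / (1 - p ^ 2) ^ 3) ≤ (laurentCoeff p F).re}

theorem admissible_congr (hp : p ∈ Ioo (0 : ℝ) 1) {F G : ℂ → ℂ} (hG : G ∈ admissible p)
    (h : EqOn F G (ball 0 1 \ {(p : ℂ)})) : F ∈ admissible p := by
  refine ⟨hG.1.congr h, ?_, fun v hv hv0 hvp => ?_, ?_⟩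
  · rw [h ⟨mem_ball_self one_pos, (ofReal_ne_zero_of_mem hp).symm⟩, hG.2.1]
  · have := hG.2.2.1 v hv hv0 hvp
    rwa [solveOmega, ← h ⟨hv, hvp⟩] at this
  · rw [laurentCoeff_congr hp h]
    exact hG.2.2.2

theorem convex_admissible (hp : p ∈ Ioo (0 : ℝ) 1) : Convex ℝ (admissible p) := by
  intro F hF G hG a b ha hb hab
  have e : a • F + b • G = fun z => (a : ℂ) * F z + (b : ℂ) * G z := by
    funext z
    simp
  have habc : (a : ℂ) + b = 1 := by exact_mod_cast hab
  rw [e]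
  refine ⟨(hF.1.const_mul _).add (hG.1.const_mul _), by simp [hF.2.1, hG.2.1],
    fun v hv hv0 hvp => ?_, ?_⟩
  · have e2 : solveOmega p (fun z => (a : ℂ) * F z + (b : ℂ) * G z) v =
        a * solveOmega p F v + b * solveOmega p G v := by
      simp only [solveOmega]
      linear_combination (1 - (1 / v) * ((1 + (p : ℂ) ^ 2) / p)) * habc
    rw [e2]
    refine (norm_add_le _ _).trans ?_
    rw [norm_mul, norm_mul, Complex.norm_real, Complex.norm_real, Real.norm_of_nonneg ha,
      Real.norm_of_nonneg hb]
    have h1 := hF.2.2.1 v hv hv0 hvp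
    have h2 := hG.2.2.1 v hv hv0 hvp
    nlinarith
  · rw [laurentCoeff_combination hp hF.1.continuousOn hG.1.continuousOn]
    simp only [Complex.add_re, Complex.re_ofReal_mul]
    have h1 := hF.2.2.2
    have h2 := hG.2.2.2
    set B := -(p ^ 2 / (1 - p ^ 2) ^ 3)
    have : B = a * B + b * B := by rw [← add_mul, hab, one_mul]
    rw [this]
    gcongr

theorem exists_admissible_of_mem_Co (hp : p ∈ Ioo (0 : ℝ) 1) {f : Disc → Sphere} (hf : f ∈ Co p) :
    ∃ F ∈ admissible p, f = withPole p F := by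
  obtain ⟨F, rfl, hd, hord, h0, h1, hinj, hconv⟩ := hf
  obtain ⟨A, hA, hAs⟩ := exists_isConcaveAtZero hp hd hord hinj hconv
  obtain ⟨hAp, hAp'⟩ := transport_zero_and_deriv hp hd h0 h1 hAs
  have hpa := abs_lt_one_of_mem hp
  refine ⟨F, ⟨hd, h0, fun v hv hv0 hvp => norm_solveOmega_le hp hA hAs hAp hAp' hv hv0 hvp, ?_⟩,
    rfl⟩
  obtain ⟨b, c, R, hR, hexp⟩ := exists_taylor_two hA.differentiableOn
  have hpe : HasPrincipalExpansion p F (c / (1 - (p : ℂ) ^ 2)) := by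
    refine hasPrincipalExpansion_of_transport hp hR (a := A 0) (b := b) fun z hz => ?_
    rw [← hexp, hAs _ (discShift_ne_zero hpa hz.1 hz.2), discShift_neg_discShift hpa hz.1, mul_comm]
  rw [laurentCoeff_eq hp hpe]
  have hc := (hA.norm_coeff_le hR hexp).trans (norm_apply_zero_le hp hA hAp hAp')
  have hq : 0 < 1 - p ^ 2 := by nlinarith [hp.1, hp.2]
  have hn : ‖c / (1 - (p : ℂ) ^ 2)‖ ≤ p ^ 2 / (1 - p ^ 2) ^ 3 := by
    have e : (1 : ℂ) - (p : ℂ) ^ 2 = ((1 - p ^ 2 : ℝ) : ℂ) := by push_cast; ring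
    rw [norm_div, e, Complex.norm_real, Real.norm_of_nonneg hq.le, div_le_iff₀ hq]
    refine hc.trans_eq ?_
    field_simp
  have := (abs_le.1 (Complex.abs_re_le_norm (c / (1 - (p : ℂ) ^ 2)))).1
  linarith

/-- In the representation the numerator is at most `1 + 1 * 2 * 1 = 3`, and the denominator does not
vanish on `K`. -/
theorem exists_norm_le_of_admissible (hp : p ∈ Ioo (0 : ℝ) 1) {K : Set ℂ} (hK : IsCompact K)
    (hKs : K ⊆ ball 0 1 \ {(p : ℂ)}) :
    ∃ M : ℝ, ∀ F ∈ admissible p, ∀ z ∈ K, ‖F z‖ ≤ M := by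
  have hne : ∀ z ∈ K, (1 - z / (p : ℂ)) * (1 - z * (p : ℂ)) ≠ 0 := fun z hz =>
    mul_ne_zero (one_sub_div_ne_zero hp (hKs hz).2) (one_sub_mul_ne_zero' hp (hKs hz).1)
  have hc : ContinuousOn (fun z : ℂ => 3 / ((1 - z / (p : ℂ)) * (1 - z * (p : ℂ)))) K := by
    fun_prop (disch := assumption)
  obtain ⟨M, hM⟩ := hK.exists_bound_of_continuousOn hc
  refine ⟨M, fun F hF z hz => le_trans ?_ (hM z hz)⟩
  by_cases hz0 : z = 0
  · subst hz0
    rw [hF.2.1, norm_zero]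
    exact norm_nonneg _
  · have hb := hF.2.2.1 z (hKs hz).1 hz0 (hKs hz).2
    rw [eq_reprFormula (F := F) hp (hKs hz).1 hz0 (hKs hz).2, reprFormula, norm_div, norm_div]
    gcongr
    have hz1 : ‖z‖ ≤ 1 := le_of_lt (by simpa using (hKs hz).1)
    have hc1 : ‖(p : ℂ) / (1 + (p : ℂ) ^ 2)‖ ≤ 1 := by
      have e : (p : ℂ) / (1 + (p : ℂ) ^ 2) = ((p / (1 + p ^ 2) : ℝ) : ℂ) := by push_cast; rfl
      have h0 := hp.1
      rw [e, Complex.norm_real, Real.norm_of_nonneg (by positivity), div_le_one (by positivity)]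
      nlinarith [hp.2]
    have h2 : ‖1 + solveOmega p F z‖ ≤ 2 := by
      refine (norm_add_le _ _).trans ?_
      rw [norm_one]
      linarith
    calc _ ≤ ‖z‖ + ‖(p : ℂ) / (1 + (p : ℂ) ^ 2) * (1 + solveOmega p F z) * z ^ 2‖ := norm_sub_le _ _
      _ = ‖z‖ + ‖(p : ℂ) / (1 + (p : ℂ) ^ 2)‖ * ‖1 + solveOmega p F z‖ * ‖z‖ ^ 2 := by
        rw [norm_mul, norm_mul, norm_pow]
      _ ≤ 1 + 1 * 2 * 1 ^ 2 := by gcongr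
      _ = ‖(3 : ℂ)‖ := by norm_num

/-- A continuous function on the sphere that inverts the embedding of a large disc. -/
theorem exists_continuous_cutoff (M : ℝ) :
    ∃ τ : Sphere → ℂ, Continuous τ ∧ ∀ w : ℂ, ‖w‖ ≤ M → τ (w : Sphere) = w := by
  set ψ : ℂ → ℂ := fun w => ((max 0 (min 1 (M + 1 - ‖w‖)) : ℝ) : ℂ) * w with hψ
  refine ⟨fun x => x.elim 0 ψ, ?_, fun w hw => ?_⟩
  · rw [OnePoint.continuous_iff]
    refine ⟨?_, ?_⟩
    · rw [coclosedCompact_eq_cocompact]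
      refine tendsto_const_nhds.congr' ?_
      filter_upwards [(tendsto_norm_cocompact_atTop (E := ℂ)).eventually_gt_atTop (M + 1)] with w hw
      have : max 0 (min 1 (M + 1 - ‖w‖)) = 0 :=
        max_eq_left ((min_le_right _ _).trans (by linarith))
      simp [hψ, this]
    · simp only [OnePoint.elim_some]
      rw [hψ]
      fun_prop
  · simp only [OnePoint.elim_some, hψ]
    rw [min_eq_left (by linarith), max_eq_right zero_le_one]
    simp

/-- The uniform bounds on compact sets avoiding `p` keep the limit finite there, and composing with
a cutoff turns convergence on the sphere into uniform convergence of complex functions. All the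
defining conditions then pass to the limit. -/
theorem exists_admissible_of_tendsto (hp : p ∈ Ioo (0 : ℝ) 1) {ι : Type*} {l : Filter ι} [l.NeBot]
    {G : ι → ℂ → ℂ} (hG : ∀ᶠ i in l, G i ∈ admissible p) {f : Disc → Sphere}
    (h : ∀ K : Set Disc, IsCompact K → TendstoUniformlyOn (fun i => withPole p (G i)) f l K) :
    ∃ F ∈ admissible p, f = withPole p F := by
  classical
  have hpt : ∀ z : Disc, Tendsto (fun i => withPole p (G i) z) l (𝓝 (f z)) := fun z =>
    (h {z} isCompact_singleton).tendsto_at (mem_singleton z)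
  -- The value 0 assigned to `∞` and outside the disc is arbitrary; `f` turns out to be finite on
  -- the disc off `p`.
  set F : ℂ → ℂ := fun z => if hz : z ∈ ball (0 : ℂ) 1 then (f ⟨z, hz⟩).elim 0 id else 0 with hF
  have hfin : ∀ z ∈ ball (0 : ℂ) 1 \ {(p : ℂ)}, ∀ M : ℝ, (∀ᵉ H ∈ admissible p, ‖H z‖ ≤ M) →
      ∀ hz : z ∈ ball (0 : ℂ) 1, f ⟨z, hz⟩ = ((F z : ℂ) : Sphere) ∧ ‖F z‖ ≤ M := by
    intro z hz M hM hzb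
    have hzp : z ≠ p := hz.2
    have hcl : IsClosed (((↑) : ℂ → Sphere) '' closedBall 0 M) :=
      ((isCompact_closedBall _ _).image OnePoint.continuous_coe).isClosed
    have hmem : f ⟨z, hzb⟩ ∈ ((↑) : ℂ → Sphere) '' closedBall 0 M := by
      refine hcl.mem_of_tendsto (hpt ⟨z, hzb⟩) ?_
      filter_upwards [hG] with i hi
      rw [withPole_of_ne hzp]
      exact mem_image_of_mem _ (by simpa using hM _ hi)
    obtain ⟨w, hw, hwf⟩ := hmem
    have hFw : F z = w := by
      simp only [hF]
      rw [dif_pos hzb, ← hwf, OnePoint.elim_some, id]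
    rw [hFw]
    exact ⟨hwf.symm, by simpa using hw⟩
  have hbound : ∀ z ∈ ball (0 : ℂ) 1 \ {(p : ℂ)}, ∃ M : ℝ, ∀ᵉ H ∈ admissible p, ‖H z‖ ≤ M := by
    intro z hz
    obtain ⟨M, hM⟩ := exists_norm_le_of_admissible hp (isCompact_singleton (x := z))
      (singleton_subset_iff.2 hz)
    exact ⟨M, fun H hH => hM H hH z rfl⟩
  have hunif : ∀ K ⊆ ball (0 : ℂ) 1 \ {(p : ℂ)}, IsCompact K → TendstoUniformlyOn G F l K := by
    intro K hKs hK
    obtain ⟨M, hM⟩ := exists_norm_le_of_admissible hp hK hKs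
    obtain ⟨τ, hτc, hτ⟩ := exists_continuous_cutoff M
    have hK' : IsCompact (((↑) : Disc → ℂ) ⁻¹' K) :=
      Topology.IsInducing.subtypeVal.isCompact_preimage' hK fun z hz => ⟨⟨z, (hKs hz).1⟩, rfl⟩
    have hτu := CompactSpace.uniformContinuous_of_continuous hτc
    have h1 := hτu.comp_tendstoUniformlyOn (h _ hK')
    rw [Metric.tendstoUniformlyOn_iff] at h1 ⊢
    intro ε hε
    filter_upwards [h1 ε hε, hG] with i hi hGi z hz
    have h2 := hi ⟨z, (hKs hz).1⟩ hz
    have hzp : z ≠ p := (hKs hz).2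
    obtain ⟨e1, e2⟩ := hfin z (hKs hz) M (fun H hH => hM H hH z hz) (hKs hz).1
    simp only [Function.comp_apply] at h2
    rwa [e1, hτ _ e2, withPole_of_ne hzp, hτ _ (hM _ hGi z hz)] at h2
  have hlim : ∀ z ∈ ball (0 : ℂ) 1 \ {(p : ℂ)}, Tendsto (fun i => G i z) l (𝓝 (F z)) :=
    fun z hz => (hunif {z} (singleton_subset_iff.2 hz) isCompact_singleton).tendsto_at rfl
  have hopen : IsOpen (ball (0 : ℂ) 1 \ {(p : ℂ)}) := isOpen_ball.sdiff isClosed_singleton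
  have hFd : DifferentiableOn ℂ F (ball 0 1 \ {(p : ℂ)}) :=
    ((tendstoLocallyUniformlyOn_iff_forall_isCompact hopen).2 hunif).differentiableOn
      (hG.mono fun i hi => hi.1) hopen
  refine ⟨F, ⟨hFd, ?_, fun v hv hv0 hvp => ?_, ?_⟩, ?_⟩
  · refine tendsto_nhds_unique (hlim 0 ⟨mem_ball_self one_pos, (ofReal_ne_zero_of_mem hp).symm⟩) ?_
    exact tendsto_const_nhds.congr' (hG.mono fun i hi => hi.2.1.symm)
  · have ht : Tendsto (fun i => solveOmega p (G i) v) l (𝓝 (solveOmega p F v)) := by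
      simp only [solveOmega]
      have := hlim v ⟨hv, hvp⟩
      exact (((tendsto_const_nhds.sub ((this.mul_const _).div_const _)).mul_const _).sub
        tendsto_const_nhds)
    exact le_of_tendsto ht.norm (hG.mono fun i hi => hi.2.2.1 v hv hv0 hvp)
  · have hρ : 0 < (1 - p) / 2 := by linarith [hp.2]
    refine le_of_forall_pos_le_add fun ε hε => ?_
    have hu := Metric.tendstoUniformlyOn_iff.1
      (hunif _ (sphere_subset_ball_diff hp) (isCompact_sphere _ _)) (ε * ((1 - p) / 2))
      (by positivity)
    obtain ⟨i, hi, hGi⟩ := (hu.and hG).exists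
    have h1 := norm_laurentCoeff_sub_le hp hGi.1.continuousOn hFd.continuousOn
      (ε := ε * ((1 - p) / 2)) fun z hz => by
        have := (hi z hz).le
        rwa [dist_comm, dist_eq_norm] at this
    rw [mul_div_cancel_right₀ _ hρ.ne'] at h1
    have h2 := (Complex.re_le_norm _).trans h1
    rw [Complex.sub_re] at h2
    linarith [hGi.2.2.2]
  · funext z
    by_cases hzp : (z : ℂ) = p
    · rw [withPole_of_eq hzp]
      refine tendsto_nhds_unique (hpt z) ?_
      simp only [withPole_of_eq hzp]
      exact tendsto_const_nhds
    · rw [withPole_of_ne hzp]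
      obtain ⟨M, hM⟩ := hbound z ⟨z.2, hzp⟩
      exact (hfin z ⟨z.2, hzp⟩ M hM z.2).1

theorem exists_admissible_of_mem_closedConvexHullCo (hp : p ∈ Ioo (0 : ℝ) 1) {f : Disc → Sphere}
    (hf : f ∈ closedConvexHullCo p) : ∃ F ∈ admissible p, f = withPole p F := by
  set T : (ℂ → ℂ) → UniformOnFun Disc Sphere {K : Set Disc | IsCompact K} := fun F =>
    UniformOnFun.ofFun {K : Set Disc | IsCompact K} (withPole p F) with hT
  have hhull : convexHull ℝ (withPole p ⁻¹' Co p) ⊆ admissible p := by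
    refine convexHull_min (fun F hF => ?_) (convex_admissible hp)
    obtain ⟨G, hG, hFG⟩ := exists_admissible_of_mem_Co hp hF
    exact admissible_congr hp hG (eqOn_of_withPole_eq hFG)
  have hcl : UniformOnFun.ofFun {K : Set Disc | IsCompact K} f ∈ closure (T '' admissible p) := by
    refine closure_mono ?_ hf
    rintro _ ⟨_, ⟨F, hF, rfl⟩, rfl⟩
    exact ⟨F, hhull hF, rfl⟩
  rw [mem_closure_iff_clusterPt, ClusterPt] at hcl
  -- Membership in the closure is turned into a filter on the functions themselves, concentrated on
  -- `admissible p`, along which `T` converges to `f`.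
  set l := 𝓟 (admissible p) ⊓ comap T (𝓝 (UniformOnFun.ofFun {K : Set Disc | IsCompact K} f))
    with hl
  have hlne : l.NeBot := by
    rw [← map_neBot_iff T, hl, Filter.push_pull, map_principal, inf_comm]
    exact hcl
  have hten : Tendsto T l (𝓝 (UniformOnFun.ofFun {K : Set Disc | IsCompact K} f)) :=
    tendsto_comap.mono_left inf_le_right
  rw [UniformOnFun.tendsto_iff_tendstoUniformlyOn] at hten
  refine exists_admissible_of_tendsto hp (l := l) (G := id) ?_ hten
  exact mem_inf_of_left (mem_principal_self _)

end ClosedHull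

/-! ### The functions `f_{ω_x}` and their coefficient `a₁` -/

section ExtremalFunction

variable {p x : ℝ}

theorem omegaX_eq (hp : p ∈ Ioo (0 : ℝ) 1) {z : ℂ}
    (hz : z ∈ ball (0 : ℂ) 1) : omegaX p x z = -discShift (-x) (discShift p z) := by
  have hs := discShift_mem_ball (abs_lt_one_of_mem hp) hz
  rw [omegaX]
  change (-discShift p z - x) / (1 + x * discShift p z) = _
  rw [discShift.eq_1 (-x)]
  push_cast
  rw [← neg_div]
  congr 1 <;> ring

theorem differentiableOn_omegaX (hp : p ∈ Ioo (0 : ℝ) 1) (hx : x ∈ Ioo (0 : ℝ) 1) :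
    DifferentiableOn ℂ (omegaX p x) (ball 0 1) := by
  have hpa := abs_lt_one_of_mem hp
  have hxa : |-x| < 1 := by rw [abs_neg]; exact abs_lt_one_of_mem hx
  exact (((differentiableOn_discShift hxa).comp (differentiableOn_discShift hpa)
    fun z hz => discShift_mem_ball hpa hz).neg).congr fun z hz => omegaX_eq hp hz

theorem bijOn_omegaX (hp : p ∈ Ioo (0 : ℝ) 1) (hx : x ∈ Ioo (0 : ℝ) 1) :
    BijOn (omegaX p x) (ball 0 1) (ball 0 1) := by
  have hpa := abs_lt_one_of_mem hp
  have hxa : |-x| < 1 := by rw [abs_neg]; exact abs_lt_one_of_mem hx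
  have hneg : BijOn (fun z : ℂ => -z) (ball 0 1) (ball 0 1) :=
    InvOn.bijOn (f' := fun z => -z) ⟨fun z _ => neg_neg z, fun z _ => neg_neg z⟩
      (fun z hz => by simpa using hz) fun z hz => by simpa using hz
  exact (hneg.comp ((bijOn_discShift hxa).comp (bijOn_discShift hpa))).congr
    fun z hz => (omegaX_eq hp hz).symm

theorem withPole_omegaX_mem_reprClass (hp : p ∈ Ioo (0 : ℝ) 1) (hx : x ∈ Ioo (0 : ℝ) 1) :
    withPole p (reprFormula p (omegaX p x)) ∈ reprClass p :=
  ⟨omegaX p x, differentiableOn_omegaX hp hx, fun z hz => by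
    have := (bijOn_omegaX hp hx).mapsTo hz
    exact le_of_lt (by simpa using this), rfl⟩

/-- The coefficient of `z - p` in the Laurent expansion at `p` of the function with parameter
`omegaX p x`. -/
def extremalCoeff (p x : ℝ) : ℝ :=
  -(p ^ 2 / (1 - p ^ 2) ^ 3) *
    (1 - (1 - x) * (p ^ 2 * x * (1 + x) - 2 * p * (1 + x) + 1) / (1 + p ^ 2))

/-- Substitute `z = (s + q) / (1 + q s)`: the pole factor cancels and the right side is polynomial
in `s` and `ω`. -/
theorem reprFormula_mul_discShift {q s z ω : ℂ} (hq : q ≠ 0) (hq2 : 1 - q ^ 2 ≠ 0)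
    (hs : s * (1 - q * z) = z - q) (hsq : 1 + q * s ≠ 0) (hs0 : s ≠ 0) :
    (z - q / (1 + q ^ 2) * (1 + ω) * z ^ 2) / ((1 - z / q) * (1 - z * q)) * s =
      -q / (1 - q ^ 2) ^ 2 *
        ((s + q) * (1 + q * s) - q / (1 + q ^ 2) * (1 + ω) * (s + q) ^ 2) := by
  obtain ⟨m, hms⟩ : ∃ m : ℂ, m = 1 + q * s := ⟨_, rfl⟩
  rw [← hms] at hsq
  have hz : z = (s + q) / m := by
    rw [eq_div_iff hsq, hms]
    linear_combination -hs
  have e1 : 1 - z / q = -(s * (1 - q ^ 2)) / (q * m) := by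
    rw [hz]
    field_simp
    rw [hms]
    ring
  have e2 : 1 - z * q = (1 - q ^ 2) / m := by
    rw [hz]
    field_simp
    rw [hms]
    ring
  rw [e1, e2, hz]
  generalize q / (1 + q ^ 2) * (1 + ω) = c
  rw [← hms]
  field_simp

theorem hasPrincipalExpansion_omegaX (hp : p ∈ Ioo (0 : ℝ) 1) (hx : x ∈ Ioo (0 : ℝ) 1) :
    HasPrincipalExpansion p (reprFormula p (omegaX p x)) (extremalCoeff p x) := by
  have hpa := abs_lt_one_of_mem hp
  have hpna : |-p| < 1 := by rwa [abs_neg]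
  have hxna : |-x| < 1 := by rw [abs_neg]; exact abs_lt_one_of_mem hx
  have hp0 := ofReal_ne_zero_of_mem hp
  have hp2 := one_sub_sq_ne_zero hp
  have hp3 := one_add_sq_ne_zero p
  have hxs : ∀ s ∈ ball (0 : ℂ) 1, 1 + (x : ℂ) * s ≠ 0 := fun s hs => by
    have := one_sub_mul_ne_zero hxna hs
    push_cast at this
    rwa [neg_mul, sub_neg_eq_add] at this
  have hps : ∀ s ∈ ball (0 : ℂ) 1, 1 + (p : ℂ) * s ≠ 0 := fun s hs => by
    have := one_sub_mul_ne_zero hpna hs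
    push_cast at this
    rwa [neg_mul, sub_neg_eq_add] at this
  set C : ℂ := -p / (1 - (p : ℂ) ^ 2) ^ 2 with hC
  set k : ℂ := p / (1 + (p : ℂ) ^ 2) * (1 - x) with hk
  have e : ((extremalCoeff p x : ℝ) : ℂ) = C * (p - k * ((p : ℂ) ^ 2 * x * (1 + x) -
      2 * p * (1 + x) + 1)) / (1 - (p : ℂ) ^ 2) := by
    rw [extremalCoeff, hC, hk]
    push_cast
    field_simp
  rw [e]
  -- The data come from `1 + ω_x = (1 - x)(1 - s) / (1 + x s)` and `(1 - s) / (1 + x s) = 1 - (1 +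
  -- x) s + x (1 + x) s² - x² (1 + x) s³ / (1 + x s)`, multiplied by `(s + p)²` and sorted by powers
  -- of `s`.
  refine hasPrincipalExpansion_of_transport hp (a := C * (p - k * (p : ℂ) ^ 2))
    (b := C * (1 + (p : ℂ) ^ 2 - k * (2 * p - (p : ℂ) ^ 2 * (1 + x))))
    (R := fun s => C * k * (-(-(1 + x) + 2 * p * x * (1 + x) + x * (1 + x) * s) +
      (s + p) ^ 2 * x ^ 2 * (1 + x) / (1 + x * s))) ?_ fun z hz => ?_
  · fun_prop (disch := assumption)
  · have hsb := discShift_mem_ball hpa hz.1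
    have hs0 := discShift_ne_zero hpa hz.1 hz.2
    have hm := one_sub_mul_ne_zero hpa hz.1
    have hsm : discShift p z * (1 - p * z) = z - p := div_mul_cancel₀ _ hm
    have hω : 1 + omegaX p x z = (1 - x) * (1 - discShift p z) / (1 + x * discShift p z) := by
      have h1 := hxs _ hsb
      rw [omegaX]
      change 1 + (-discShift p z - x) / (1 + x * discShift p z) = _
      rw [eq_div_iff h1, add_mul, div_mul_cancel₀ _ h1]
      ring
    rw [reprFormula, reprFormula_mul_discShift hp0 hp2 hsm (hps _ hsb) hs0, hω, ← hC]
    have h1 := hxs _ hsb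
    have h2 : (p : ℂ) / (1 + (p : ℂ) ^ 2) * ((1 - x) * (1 - discShift p z) /
        (1 + x * discShift p z)) = k * ((1 - discShift p z) / (1 + x * discShift p z)) := by
      rw [hk]
      ring
    rw [h2]
    clear_value k C
    generalize discShift p z = s at h1 ⊢
    obtain ⟨m, hms⟩ : ∃ m : ℂ, m = 1 + x * s := ⟨_, rfl⟩
    rw [← hms] at h1 ⊢
    field_simp
    rw [hms]
    ring

/-- For `p > 1 - √2 / 2`, some extremal coefficient violates the bound that is valid in `Co p`. -/
theorem exists_extremalCoeff_lt (hp : p ∈ Ioo (1 - Real.sqrt 2 / 2) 1) (hp0 : 0 < p) :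
    ∃ x ∈ Ioo (0 : ℝ) 1, extremalCoeff p x < -(p ^ 2 / (1 - p ^ 2) ^ 3) := by
  -- The bracket of `extremalCoeff` at `x = 1` is `2 (1 - p)² - 1`. By continuity it stays negative
  -- for `x < 1` near 1, where the factor `1 - x` is positive.
  have hneg : p ^ 2 * 1 * (1 + 1) - 2 * p * (1 + 1) + 1 < 0 := by
    have h1 : 1 - p < Real.sqrt 2 / 2 := by linarith [hp.1]
    have h2 : Real.sqrt 2 ^ 2 = 2 := Real.sq_sqrt zero_le_two
    have h3 : 0 < 1 - p := by linarith [hp.2]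
    nlinarith
  have hc : Continuous fun x : ℝ => p ^ 2 * x * (1 + x) - 2 * p * (1 + x) + 1 := by fun_prop
  have hev : ∀ᶠ x in 𝓝[<] (1 : ℝ), p ^ 2 * x * (1 + x) - 2 * p * (1 + x) + 1 < 0 :=
    eventually_nhdsWithin_of_eventually_nhds ((hc.tendsto 1).eventually_lt_const hneg)
  obtain ⟨x, hE, hx⟩ := (hev.and (Ioo_mem_nhdsLT (zero_lt_one' ℝ))).exists
  refine ⟨x, hx, ?_⟩
  have hq : 0 < 1 - p ^ 2 := by nlinarith [hp.2]
  have hB : 0 < p ^ 2 / (1 - p ^ 2) ^ 3 := by positivity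
  have hfrac : (1 - x) * (p ^ 2 * x * (1 + x) - 2 * p * (1 + x) + 1) / (1 + p ^ 2) < 0 :=
    div_neg_of_neg_of_pos (mul_neg_of_pos_of_neg (by linarith [hx.2]) hE) (by positivity)
  rw [extremalCoeff]
  nlinarith

end ExtremalFunction

end ConcaveUnivalent

end

/-! ### Conclusion -/

open ConcaveUnivalent in
theorem theorem5 (p : ℝ) (hp : p ∈ Set.Ioo (1 - Real.sqrt 2 / 2) 1) :
    closedConvexHullCo p ⊂ reprClass p ∧
    ∃ x ∈ Set.Ioo (0 : ℝ) 1,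
      DifferentiableOn ℂ (omegaX p x) (Metric.ball (0 : ℂ) 1) ∧
      Set.BijOn (omegaX p x) (Metric.ball (0 : ℂ) 1) (Metric.ball (0 : ℂ) 1) ∧
      withPole p (reprFormula p (omegaX p x)) ∈ reprClass p ∧
      withPole p (reprFormula p (omegaX p x)) ∉ closedConvexHullCo p ∧
      ∃ a : ℤ → ℂ, HasLaurentExpansion p (withPole p (reprFormula p (omegaX p x))) a ∧
        ∃ r : ℝ, a 1 = (r : ℂ) ∧ r < -(p ^ 2 / (1 - p ^ 2) ^ 3) := by
  have hp0 : 0 < p := by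
    have h : Real.sqrt 2 ≤ 2 := Real.sqrt_le_left (by norm_num) |>.2 (by norm_num)
    linarith [hp.1]
  have hp' : p ∈ Set.Ioo (0 : ℝ) 1 := ⟨hp0, hp.2⟩
  obtain ⟨x, hx, hlt⟩ := exists_extremalCoeff_lt hp hp0
  have hexp := hasPrincipalExpansion_omegaX hp' hx
  have hmem := withPole_omegaX_mem_reprClass hp' hx
  have hnot : withPole p (reprFormula p (omegaX p x)) ∉ closedConvexHullCo p := by
    intro h
    obtain ⟨F, hF, hFe⟩ := exists_admissible_of_mem_closedConvexHullCo hp' h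
    have h1 := hF.2.2.2
    rw [← laurentCoeff_congr hp' (eqOn_of_withPole_eq hFe), laurentCoeff_eq hp' hexp,
      Complex.ofReal_re] at h1
    linarith
  refine ⟨⟨fun f hf => ?_, fun h => hnot (h hmem)⟩, x, hx, differentiableOn_omegaX hp' hx,
    bijOn_omegaX hp' hx, hmem, hnot, ?_⟩
  · obtain ⟨F, hF, rfl⟩ := exists_admissible_of_mem_closedConvexHullCo hp' hf
    exact withPole_mem_reprClass hp' hF.1 hF.2.1 hF.2.2.1
  · obtain ⟨a, ha, ha1⟩ := hasLaurentExpansion_of_principal hp' hexp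
    exact ⟨a, ha, extremalCoeff p x, ha1, hlt⟩
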